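/- For a Dirichlet character $\chi$ mod $N$ let $\tau(\chi)=\sum_{b=1}^{N}\chi(b)e^{2\pi i b/N}$ be its Gauss sum, and let $\chi_0$ denote the principal character mod $N$. Let $\mathcal{D}_{\pm}(N)$ be the set of primitive Dirichlet characters $\chi$ mod $N$ with $\chi(-1)=\pm1$, and let $\mathcal{I}_{\pm}(N)$ be the set of imprimitive Dirichlet characters $\chi\neq\chi_0$ mod $N$ with $\chi(-1)=\pm1$. For $x\in\mathbb{R}_{>0}$ let $\lceil x\rceil^{\mathfrak p}$ be the smallest prime that is at least $x$. For $\delta\in(0,1)$, $y\in\mathbb{R}_{>0}$ and real $X>0$ put \[ \widetilde{Q}_{\pm}(y,X,\delta)=\frac{1}{X^{\delta}}\sum_{\substack{N\in[X,X+X^{\delta}]\\ N\not\equiv 2\bmod 4}}\ \sum_{\chi\in\mathcal{D}_{\pm}(N)}\frac{\chi(\lceil yX\rceil^{\mathfrak p})}{\tau(\chi)}, \] \[ \widetilde{E}_{\pm}(y,X,\delta)=\frac{1}{X^{\delta}}\sum_{\substack{N\in[X,X+X^{\delta}]\\ N\not\equiv 2\bmod 4}}\frac1N\sum_{\chi\in\mathcal{I}_{\pm}(N)}\tau(\overline{\chi})\,\chi(\lceil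 yX\rceil^{\mathfrak p}), \] where $N$ runs over integers, and \[ \widetilde{T}_{\pm}(y,X,\delta)=\widetilde{Q}_{\pm}(y,X,\delta)\pm\widetilde{E}_{\pm}(y,X,\delta). \] Then (unconditionally) for every $\delta\in(0,1)$ and every $y\in\mathbb{R}_{>0}$, \[ \lim_{X\to\infty}\widetilde{T}_{+}(y,X,\delta)=\frac{5}{\pi^2}\cos(2\pi y),\qquad \lim_{X\to\infty}\widetilde{T}_{-}(y,X,\delta)=-i\,\frac{5}{\pi^2}\sin(2\pi y). \] -/

import Mathlib

open Filter Topology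

noncomputable section

namespace Murmuration

/-- The Gauss sum `τ(χ) = ∑_{b=1}^{N} χ(b) e^{2πib/N}` of a Dirichlet character mod `N`. -/
def tau {N : ℕ} (χ : DirichletCharacter ℂ N) : ℂ :=
  ∑ b ∈ Finset.Icc 1 N, χ (b : ZMod N) * Complex.exp (2 * Real.pi * Complex.I * b / N)

/-- For `N ≥ 1`, `tau` is Mathlib's Gauss sum with respect to the standard additive character. -/
theorem tau_eq_gaussSum {N : ℕ} [NeZero N] (χ : DirichletCharacter ℂ N) :
    tau χ = gaussSum χ (ZMod.stdAddChar (N := N)) := by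
  rw [tau, gaussSum]
  refine Finset.sum_bij (fun b _ => (b : ZMod N)) (fun _ _ => Finset.mem_univ _) ?_ ?_ ?_
  · intro a ha b hb h
    rw [Finset.mem_Icc] at ha hb
    have h' := (ZMod.natCast_eq_natCast_iff _ _ _).1 h
    rcases le_total a b with hab | hab
    · have := Nat.eq_zero_of_dvd_of_lt ((Nat.modEq_iff_dvd' hab).1 h') (by omega)
      omega
    · have := Nat.eq_zero_of_dvd_of_lt ((Nat.modEq_iff_dvd' hab).1 h'.symm) (by omega)
      omega
  · intro z _
    by_cases hz : z.val = 0
    · refine ⟨N, Finset.mem_Icc.2 ⟨Nat.one_le_iff_ne_zero.2 (NeZero.ne N), le_rfl⟩, ?_⟩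
      rw [ZMod.natCast_self, (ZMod.val_eq_zero z).1 hz]
    · exact ⟨z.val, Finset.mem_Icc.2 ⟨Nat.one_le_iff_ne_zero.2 hz, z.val_lt.le⟩,
        ZMod.natCast_zmod_val z⟩
  · intro b _
    have := ZMod.stdAddChar_coe (N := N) (b : ℤ)
    push_cast at this
    rw [this]

open Classical in
/-- `D_ε(N)`: the primitive Dirichlet characters `χ` mod `N` with `χ(-1) = ε`, for a sign `ε`. -/
def primitiveChars (ε : ℤˣ) (N : ℕ) : Finset (DirichletCharacter ℂ N) :=
  Finset.univ.filter fun χ => χ.IsPrimitive ∧ χ (-1) = ((ε : ℤ) : ℂ)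

open Classical in
/-- `I_ε(N)`: the imprimitive, non-principal Dirichlet characters `χ` mod `N` with
`χ(-1) = ε`, for a sign `ε`. -/
def imprimitiveChars (ε : ℤˣ) (N : ℕ) : Finset (DirichletCharacter ℂ N) :=
  Finset.univ.filter fun χ => ¬ χ.IsPrimitive ∧ χ ≠ 1 ∧ χ (-1) = ((ε : ℤ) : ℂ)

/-- The smallest prime that is at least `x`. -/
def primeCeil (x : ℝ) : ℕ := sInf {p : ℕ | p.Prime ∧ x ≤ p}

/-- The integers `N ∈ [X, X + X^δ]` with `N ≢ 2 mod 4` (for `X > 0`). -/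
def shortConductors (X δ : ℝ) : Finset ℕ :=
  (Finset.Icc ⌈X⌉₊ ⌊X + X ^ δ⌋₊).filter fun N => ¬ N ≡ 2 [MOD 4]

/-- The average over primitive characters,
`X^{-δ} ∑_N ∑_{χ ∈ D_ε(N)} χ(⌈yX⌉^𝔭) / τ(χ)`. -/
def Qtilde (ε : ℤˣ) (y X δ : ℝ) : ℂ :=
  1 / ((X ^ δ : ℝ) : ℂ) * ∑ N ∈ shortConductors X δ, ∑ χ ∈ primitiveChars ε N,
    χ (primeCeil (y * X) : ZMod N) / tau χ

/-- The average over imprimitive characters,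
`X^{-δ} ∑_N N⁻¹ ∑_{χ ∈ I_ε(N)} τ(χ̄) χ(⌈yX⌉^𝔭)`. -/
def Etilde (ε : ℤˣ) (y X δ : ℝ) : ℂ :=
  1 / ((X ^ δ : ℝ) : ℂ) * ∑ N ∈ shortConductors X δ, 1 / (N : ℂ) *
    ∑ χ ∈ imprimitiveChars ε N, tau (star χ) * χ (primeCeil (y * X) : ZMod N)

/-- `T̃_± = Q̃_± ± Ẽ_±`, the sign being `ε`. -/
def Ttilde (ε : ℤˣ) (y X δ : ℝ) : ℂ :=
  Qtilde ε y X δ + ((ε : ℤ) : ℂ) * Etilde ε y X δ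

end Murmuration

end

/-!
Since `τ(χ) τ(χ̄) = χ(-1) N` for primitive `χ`, the modulus `N` contributes to `T̃_ε` the sum of
`ε τ(χ̄) χ(p) / N` over all non-principal `χ` of parity `ε`, primitive or not. The principal
character has Gauss sum `μ(N)`, so restoring it costs `O(1 / N)`, and orthogonality over all
characters of parity `ε` leaves `φ(N) / N` times `cos (2πp / N)` or `-i sin (2πp / N)` when `p ∤ N`.
The mean of `φ(N) / N = ∑_{d ∣ N} μ(d) / d` over `N ≢ 2 mod 4` in a short interval is `5 / π ^ 2`,
so it remains to see that `p / N` tends to `y`, that is, that the smallest prime `≥ x` is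
asymptotic to `x`.

That there is a prime in `[x, (1 + η) x]` for large `x` is extracted from the absence of zeros of
`ζ` on `re s = 1`: weight each prime `p` by `log p`. The Dirichlet series of these weights differs
from `-ζ' / ζ` by the contribution of the higher prime powers, which is harmless on `re s = 1`. If
the interval contained no prime, the average of the weights against a Fejér kernel concentrated at
`log x` would be small, whereas, as that kernel has compactly supported Fourier transform, the
simple pole at `s = 1` and the Riemann-Lebesgue lemma for the continuous remainder force this
average to be bounded below.
-/

noncomputable section

namespace Murmuration

open ArithmeticFunction

section Fejer

/-- The Fejér kernel at scale `T`, normalised as the cosine transform of the triangle weight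
`1 - t / T` on `[0, T]`. -/
def fejer (T u : ℝ) : ℝ := ∫ t in (0 : ℝ)..T, (1 - t / T) * Real.cos (t * u)

/-- The Fourier integral at `x` of `F`, weighted by `1 - t / T`, over `[0, T]`. Its value at the
constant function `1` has real part `fejer T x`. -/
def triangleIntegral (T : ℝ) (F : ℝ → ℂ) (x : ℝ) : ℂ :=
  ∫ t in (0 : ℝ)..T, ((1 - t / T : ℝ) : ℂ) * Complex.exp (Complex.I * (t * x : ℝ)) * F t

variable {T : ℝ}

theorem fejer_of_ne_zero (hT : 0 < T) {u : ℝ} (hu : u ≠ 0) :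
    fejer T u = (1 - Real.cos (T * u)) / (T * u ^ 2) := by
  have hderiv : ∀ t ∈ Set.uIcc 0 T, HasDerivAt
      (fun t => (1 - t / T) * (Real.sin (t * u) / u) - Real.cos (t * u) / (T * u ^ 2))
      ((1 - t / T) * Real.cos (t * u)) t := by
    intro t _
    have hweight : HasDerivAt (fun t : ℝ => 1 - t / T) (-(1 / T)) t := by
      simpa using ((hasDerivAt_id t).div_const T).const_sub 1
    have hmul : HasDerivAt (fun t : ℝ => t * u) u t := by
      simpa using (hasDerivAt_id t).mul_const u
    refine ((hweight.mul (hmul.sin.div_const u)).sub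
      (hmul.cos.div_const (T * u ^ 2))).congr_deriv ?_
    field_simp
    ring
  rw [fejer, intervalIntegral.integral_eq_sub_of_hasDerivAt hderiv
    (Continuous.intervalIntegrable (by fun_prop) _ _)]
  simp only [div_self hT.ne', sub_self, zero_mul, zero_div, sub_zero, Real.sin_zero,
    Real.cos_zero, mul_zero]
  ring

theorem fejer_zero (hT : 0 < T) : fejer T 0 = T / 2 := by
  simp only [fejer, mul_zero, Real.cos_zero, mul_one]
  rw [intervalIntegral.integral_sub intervalIntegrable_const
    (Continuous.intervalIntegrable (by fun_prop) _ _), intervalIntegral.integral_div, integral_id,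
    intervalIntegral.integral_const]
  simp only [smul_eq_mul]
  field_simp
  ring

theorem fejer_nonneg (hT : 0 < T) (u : ℝ) : 0 ≤ fejer T u := by
  rcases eq_or_ne u 0 with rfl | hu
  · rw [fejer_zero hT]; positivity
  · rw [fejer_of_ne_zero hT hu]
    exact div_nonneg (sub_nonneg.2 (Real.cos_le_one _)) (by positivity)

theorem fejer_le_of_le_abs (hT : 0 < T) {η u : ℝ} (hη : 0 < η) (hu : η ≤ |u|) :
    fejer T u ≤ 2 / T * (1 + 1 / η ^ 2) / (1 + u ^ 2) := by
  have hsq : η ^ 2 ≤ u ^ 2 := by rw [← sq_abs u]; gcongr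
  have hu2 : 0 < u ^ 2 := (by positivity : 0 < η ^ 2).trans_le hsq
  have hu0 : u ≠ 0 := by rintro rfl; simp at hu2
  calc fejer T u = (1 - Real.cos (T * u)) / (T * u ^ 2) := fejer_of_ne_zero hT hu0
    _ ≤ 2 / (T * u ^ 2) := by gcongr; linarith [Real.neg_one_le_cos (T * u)]
    _ = 2 / T * ((1 + 1 / u ^ 2) / (1 + u ^ 2)) := by field_simp; ring
    _ ≤ 2 / T * ((1 + 1 / η ^ 2) / (1 + u ^ 2)) := by gcongr
    _ = 2 / T * (1 + 1 / η ^ 2) / (1 + u ^ 2) := by ring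

theorem le_fejer_of_abs_mul_le_one (hT : 0 < T) {u : ℝ} (hu : |T * u| ≤ 1) :
    T / 4 ≤ fejer T u := by
  have hmono : ∫ t in (0 : ℝ)..T, (1 / 2) * ((1 - t / T) * Real.cos (t * 0)) ≤ fejer T u := by
    refine intervalIntegral.integral_mono_on hT.le
      (Continuous.intervalIntegrable (by fun_prop) _ _)
      (Continuous.intervalIntegrable (by fun_prop) _ _) fun t ht => ?_
    have hweight : 0 ≤ 1 - t / T := sub_nonneg.2 ((div_le_one hT).2 ht.2)
    have htu : (t * u) ^ 2 ≤ 1 := by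
      rw [sq_le_one_iff_abs_le_one]
      refine le_trans ?_ hu
      rw [abs_mul, abs_mul, abs_of_nonneg ht.1, abs_of_pos hT]
      exact mul_le_mul_of_nonneg_right ht.2 (abs_nonneg _)
    have hcos : 1 / 2 ≤ Real.cos (t * u) := by
      linarith [Real.one_sub_sq_div_two_le_cos (x := t * u)]
    rw [mul_zero, Real.cos_zero, mul_one, mul_comm]
    exact mul_le_mul_of_nonneg_left hcos hweight
  rw [intervalIntegral.integral_const_mul, ← fejer, fejer_zero hT] at hmono
  linarith

theorem re_triangleIntegral_one (T u : ℝ) : (triangleIntegral T (fun _ => 1) u).re = fejer T u := by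
  have hint : IntervalIntegrable (fun t : ℝ => ((1 - t / T : ℝ) : ℂ) *
      Complex.exp (Complex.I * (t * u : ℝ)) * 1) MeasureTheory.volume 0 T :=
    Continuous.intervalIntegrable (by fun_prop) _ _
  rw [triangleIntegral, ← Complex.reCLM_apply, ← Complex.reCLM.intervalIntegral_comp_comm hint]
  refine intervalIntegral.integral_congr fun t _ => ?_
  simp only [Complex.reCLM_apply, mul_one, mul_comm Complex.I, Complex.re_ofReal_mul,
    Complex.exp_ofReal_mul_I_re]

theorem norm_triangle_mul_exp_le_one {t : ℝ} (ht : t ∈ Set.Icc 0 T) (x : ℝ) :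
    ‖((1 - t / T : ℝ) : ℂ) * Complex.exp (Complex.I * (t * x : ℝ))‖ ≤ 1 := by
  have hT : 0 ≤ T := ht.1.trans ht.2
  rw [norm_mul, mul_comm Complex.I, Complex.norm_exp_ofReal_mul_I, mul_one, Complex.norm_real,
    Real.norm_eq_abs, abs_of_nonneg (sub_nonneg.2 (div_le_one_of_le₀ ht.2 hT))]
  linarith [div_nonneg ht.1 hT]

theorem hasSum_triangleIntegral (hT : 0 ≤ T) {F : ℕ → ℝ → ℂ} {G : ℝ → ℂ} {b : ℕ → ℝ}
    (hF : ∀ n, Continuous (F n)) (hFb : ∀ n t, ‖F n t‖ ≤ b n) (hb : Summable b)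
    (hFG : ∀ t, HasSum (fun n => F n t) (G t)) (x : ℝ) :
    HasSum (fun n => triangleIntegral T (F n) x) (triangleIntegral T G x) := by
  refine intervalIntegral.hasSum_integral_of_dominated_convergence (fun n _ => b n)
    (fun n => Continuous.aestronglyMeasurable (by fun_prop)) (fun n => .of_forall fun t ht => ?_)
    (.of_forall fun _ _ => hb) intervalIntegrable_const
    (.of_forall fun t _ => (hFG t).mul_left _)
  rw [Set.uIoc_of_le hT] at ht
  rw [norm_mul]
  exact (mul_le_of_le_one_left (norm_nonneg _)
    (norm_triangle_mul_exp_le_one (Set.Ioc_subset_Icc_self ht) x)).trans (hFb n t)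

theorem tendsto_triangleIntegral_atTop (hT : 0 ≤ T) (F : ℝ → ℂ) :
    Tendsto (triangleIntegral T F) atTop (𝓝 0) := by
  have hRL := Real.tendsto_integral_exp_smul_cocompact
    ((Set.Ioc 0 T).indicator fun t => ((1 - t / T : ℝ) : ℂ) * F t)
  have hscale : Tendsto (fun x : ℝ => -(x / (2 * Real.pi))) atTop (cocompact ℝ) :=
    (tendsto_neg_atTop_atBot.comp (tendsto_id.atTop_div_const (by positivity))).mono_right
      atBot_le_cocompact
  refine (hRL.comp hscale).congr fun x => ?_
  rw [triangleIntegral, intervalIntegral.integral_of_le hT,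
    ← MeasureTheory.integral_indicator measurableSet_Ioc]
  refine MeasureTheory.integral_congr_ae (.of_forall fun t => ?_)
  by_cases ht : t ∈ Set.Ioc 0 T
  · simp only [Set.indicator_of_mem ht, Circle.smul_def, Real.fourierChar_apply, smul_eq_mul]
    rw [← mul_assoc, mul_comm (Complex.exp _)]
    congr 3
    push_cast
    field_simp
  · simp [Set.indicator_of_notMem ht]

theorem tendsto_triangleIntegral_verticalLine {H : ℂ → ℂ} {σ₀ : ℝ}
    (hH : ContinuousOn H {s | σ₀ ≤ s.re}) (T x : ℝ) :
    Tendsto (fun σ : ℝ => triangleIntegral T (fun t => H (σ + Complex.I * t)) x) (𝓝[>] σ₀)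
      (𝓝 (triangleIntegral T (fun t => H (σ₀ + Complex.I * t)) x)) := by
  have hcont : ContinuousOn (fun p : ℝ × ℝ => ((1 - p.2 / T : ℝ) : ℂ) *
      Complex.exp (Complex.I * (p.2 * x : ℝ)) * H (p.1 + Complex.I * p.2))
      (Set.Ici σ₀ ×ˢ Set.univ) :=
    ContinuousOn.mul (Continuous.continuousOn (by fun_prop))
      (hH.comp (Continuous.continuousOn (by fun_prop)) fun p hp => by simpa using hp.1)
  have hcont_left (t : ℝ) : ContinuousOn (fun σ : ℝ => ((1 - t / T : ℝ) : ℂ) *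
      Complex.exp (Complex.I * (t * x : ℝ)) * H (σ + Complex.I * t)) (Set.Ici σ₀) :=
    hcont.comp (f := fun σ => (σ, t)) (by fun_prop) fun σ hσ => ⟨hσ, trivial⟩
  have hcont_right {σ : ℝ} (hσ : σ₀ ≤ σ) : Continuous fun t : ℝ => ((1 - t / T : ℝ) : ℂ) *
      Complex.exp (Complex.I * (t * x : ℝ)) * H (σ + Complex.I * t) :=
    hcont.comp_continuous (f := fun t => (σ, t)) (by fun_prop) fun t => ⟨hσ, trivial⟩
  obtain ⟨C, hC⟩ := (isCompact_Icc.prod isCompact_uIcc).exists_bound_of_continuousOn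
    (hcont.mono (Set.prod_mono (Set.Icc_subset_Ici_self : Set.Icc σ₀ (σ₀ + 1) ⊆ Set.Ici σ₀)
      (Set.subset_univ (Set.uIcc 0 T))))
  have hnear : ∀ᶠ σ : ℝ in 𝓝[>] σ₀, σ ∈ Set.Ioo σ₀ (σ₀ + 1) := Ioo_mem_nhdsGT (by linarith)
  refine intervalIntegral.tendsto_integral_filter_of_dominated_convergence (fun _ => C) ?_ ?_
    intervalIntegrable_const (.of_forall fun t _ => ?_)
  · filter_upwards [hnear] with σ hσ using (hcont_right hσ.1.le).aestronglyMeasurable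
  · filter_upwards [hnear] with σ hσ using .of_forall fun t ht =>
      hC (σ, t) ⟨Set.Ioo_subset_Icc_self hσ, Set.uIoc_subset_uIcc ht⟩
  · exact (hcont_left t σ₀ Set.self_mem_Ici).tendsto.mono_left
      (nhdsWithin_mono _ Set.Ioi_subset_Ici_self)

end Fejer

section LSeries

theorem term_add_I_mul (f : ℕ → ℂ) (s : ℂ) (t : ℝ) (n : ℕ) :
    LSeries.term f (s + Complex.I * t) n =
      LSeries.term f s n * Complex.exp (-(Complex.I * (t * Real.log n : ℝ))) := by
  rcases eq_or_ne n 0 with rfl | hn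
  · simp
  · rw [LSeries.term_of_ne_zero hn, LSeries.term_of_ne_zero hn,
      Complex.cpow_add _ _ (Nat.cast_ne_zero.2 hn), ← div_div, div_eq_mul_inv (f n / _),
      Complex.cpow_def_of_ne_zero (Nat.cast_ne_zero.2 hn) (Complex.I * t), ← Complex.exp_neg,
      ← Complex.natCast_log]
    congr 3
    push_cast
    ring

theorem triangleIntegral_term (T : ℝ) (f : ℕ → ℂ) (s : ℂ) (n : ℕ) (x : ℝ) :
    triangleIntegral T (fun t => LSeries.term f (s + Complex.I * t) n) x =
      LSeries.term f s n * triangleIntegral T (fun _ => 1) (x - Real.log n) := by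
  rw [triangleIntegral, triangleIntegral, ← intervalIntegral.integral_const_mul]
  refine intervalIntegral.integral_congr fun t _ => ?_
  have hexp : Complex.exp (Complex.I * (t * (x - Real.log n) : ℝ)) =
      Complex.exp (Complex.I * (t * x : ℝ)) *
        Complex.exp (-(Complex.I * (t * Real.log n : ℝ))) := by
    rw [← Complex.exp_add]
    congr 1
    push_cast
    ring
  simp only [term_add_I_mul, hexp]
  ring

theorem term_ofReal {σ : ℝ} (hσ : σ ≠ 0) (a : ℕ → ℝ) (n : ℕ) :
    LSeries.term (fun n => (a n : ℂ)) σ n = ((a n * (n : ℝ) ^ (-σ) : ℝ) : ℂ) := by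
  rcases eq_or_ne n 0 with rfl | hn
  · simp [Real.zero_rpow (neg_ne_zero.2 hσ)]
  · rw [LSeries.term_of_ne_zero hn, Real.rpow_neg n.cast_nonneg, ← div_eq_mul_inv]
    push_cast [Complex.ofReal_cpow n.cast_nonneg]
    rfl

theorem hasSum_mul_fejer {T : ℝ} (hT : 0 ≤ T) {a : ℕ → ℝ} {H : ℂ → ℂ} {σ : ℝ} (hσ : σ ≠ 0)
    (hH : ∀ t : ℝ, LSeriesHasSum (fun n => (a n : ℂ)) (σ + Complex.I * t) (H (σ + Complex.I * t)))
    (x : ℝ) :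
    HasSum (fun n : ℕ => a n * (n : ℝ) ^ (-σ) * fejer T (x - Real.log n))
      (triangleIntegral T (fun t => H (σ + Complex.I * t)) x).re := by
  have hsummable : Summable fun n => ‖LSeries.term (fun n => (a n : ℂ)) σ n‖ := by
    simpa using (hH 0).LSeriesSummable.norm
  have hterm (n : ℕ) (t : ℝ) : ‖LSeries.term (fun n => (a n : ℂ)) (σ + Complex.I * t) n‖ ≤
      ‖LSeries.term (fun n => (a n : ℂ)) σ n‖ := by
    simp only [LSeries.norm_term_eq, Complex.add_re, Complex.re_mul_ofReal, Complex.I_re, zero_mul,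
      add_zero, le_refl]
  have hcont (n : ℕ) :
      Continuous fun t : ℝ => LSeries.term (fun n => (a n : ℂ)) (σ + Complex.I * t) n := by
    simp only [term_add_I_mul]
    fun_prop
  refine (Complex.hasSum_re (hasSum_triangleIntegral hT hcont hterm hsummable hH x)).congr_fun
    fun n => ?_
  rw [triangleIntegral_term, term_ofReal hσ, Complex.re_ofReal_mul, re_triangleIntegral_one]

theorem continuousOn_LSeries_of_LSeriesSummable {f : ℕ → ℂ} {x : ℝ} (hf : LSeriesSummable f x) :
    ContinuousOn (LSeries f) {s | x ≤ s.re} := by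
  refine continuousOn_tsum (fun n => ?_) hf.norm fun n s hs =>
    LSeries.norm_term_le_of_re_le_re f (by simpa using hs) n
  rcases eq_or_ne n 0 with rfl | hn
  · simpa using continuousOn_const
  · simp only [LSeries.term_of_ne_zero hn]
    have : NeZero (n : ℂ) := ⟨Nat.cast_ne_zero.2 hn⟩
    exact (continuous_const.div (continuous_const_cpow (n : ℂ)) fun s =>
      Complex.cpow_ne_zero_iff.2 (.inl (NeZero.ne _))).continuousOn

end LSeries

section Tauberian

theorem summable_one_div_one_add_int_sq : Summable fun i : ℤ => 1 / (1 + (i : ℝ) ^ 2) := by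
  refine .of_norm_bounded_eventually (Real.summable_one_div_int_pow.2 one_lt_two) ?_
  filter_upwards [(Set.finite_singleton (0 : ℤ)).compl_mem_cofinite] with i hi
  have hi0 : (0 : ℝ) < (i : ℝ) ^ 2 := by
    have : (i : ℝ) ≠ 0 := Int.cast_ne_zero.2 hi
    positivity
  rw [Real.norm_of_nonneg (by positivity)]
  gcongr
  linarith

theorem one_div_one_add_sq_le_floor (u : ℝ) :
    1 / (1 + u ^ 2) ≤ 3 * (1 / (1 + (⌊u⌋ : ℝ) ^ 2)) := by
  have hle := Int.floor_le u
  have hlt := Int.lt_floor_add_one u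
  have hsq : (⌊u⌋ : ℝ) ^ 2 ≤ (|u| + 1) ^ 2 :=
    sq_le_sq' (by linarith [neg_abs_le u]) (by linarith [le_abs_self u])
  rw [mul_one_div, div_le_div_iff₀ (by positivity) (by positivity)]
  nlinarith [sq_nonneg (|u| - 1), sq_abs u]

section Chebyshev

variable {a : ℕ → ℝ} (ha : ∀ n, 0 ≤ a n) {C : ℝ}
  (hC : ∀ x : ℝ, 0 ≤ x → ∑ n ∈ Finset.Ioc 0 ⌊x⌋₊, a n ≤ C * x)
include ha hC

theorem sum_div_le_of_log_mem_Icc {s : Finset ℕ} {y : ℝ}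
    (hs : ∀ n ∈ s, Real.log n ∈ Set.Icc y (y + 1)) : ∑ n ∈ s, a n / n ≤ C * Real.exp 1 := by
  have hmem {n : ℕ} (hn : n ∈ s.erase 0) :
      0 < n ∧ Real.exp y ≤ n ∧ (n : ℝ) ≤ Real.exp (y + 1) := by
    obtain ⟨hn0, hns⟩ := Finset.mem_erase.1 hn
    have hpos : (0 : ℝ) < n := Nat.cast_pos.2 (Nat.pos_of_ne_zero hn0)
    exact ⟨Nat.pos_of_ne_zero hn0, (Real.le_log_iff_exp_le hpos).1 (hs n hns).1,
      (Real.log_le_iff_le_exp hpos).1 (hs n hns).2⟩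
  calc ∑ n ∈ s, a n / n = ∑ n ∈ s.erase 0, a n / n := (Finset.sum_erase _ (by simp)).symm
    _ ≤ ∑ n ∈ s.erase 0, Real.exp (-y) * a n := by
      refine Finset.sum_le_sum fun n hn => ?_
      rw [Real.exp_neg, div_eq_inv_mul]
      exact mul_le_mul_of_nonneg_right (inv_anti₀ (Real.exp_pos _) (hmem hn).2.1) (ha n)
    _ ≤ ∑ n ∈ Finset.Ioc 0 ⌊Real.exp (y + 1)⌋₊, Real.exp (-y) * a n :=
      Finset.sum_le_sum_of_subset_of_nonneg
        (fun n hn => Finset.mem_Ioc.2 ⟨(hmem hn).1, Nat.le_floor (hmem hn).2.2⟩)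
        fun n _ _ => mul_nonneg (Real.exp_pos _).le (ha n)
    _ ≤ Real.exp (-y) * (C * Real.exp (y + 1)) := by
      rw [← Finset.mul_sum]
      gcongr
      exact hC _ (Real.exp_pos _).le
    _ = C * Real.exp 1 := by
      rw [mul_left_comm, ← Real.exp_add]
      ring_nf

theorem exists_sum_div_one_add_sq_le :
    ∃ K : ℝ, ∀ (x : ℝ) (s : Finset ℕ), ∑ n ∈ s, a n / n / (1 + (x - Real.log n) ^ 2) ≤ K := by
  set B : ℝ := C * Real.exp 1
  have hB : 0 ≤ B := by
    simpa using sum_div_le_of_log_mem_Icc ha hC (s := ∅) (y := 0) (by simp)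
  refine ⟨3 * B * ∑' i : ℤ, 1 / (1 + (i : ℝ) ^ 2), fun x s => ?_⟩
  set window : ℕ → ℤ := fun n => ⌊Real.log n - x⌋
  calc ∑ n ∈ s, a n / n / (1 + (x - Real.log n) ^ 2)
      ≤ ∑ n ∈ s, a n / n * (3 * (1 / (1 + (window n : ℝ) ^ 2))) := by
        refine Finset.sum_le_sum fun n _ => ?_
        rw [div_eq_mul_one_div (a n / n), ← neg_sq (x - _), neg_sub]
        exact mul_le_mul_of_nonneg_left (one_div_one_add_sq_le_floor _)
          (div_nonneg (ha n) n.cast_nonneg)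
    _ = ∑ i ∈ s.image window, (∑ n ∈ s with window n = i, a n / n) *
          (3 * (1 / (1 + (i : ℝ) ^ 2))) := by
        rw [← Finset.sum_fiberwise_of_maps_to fun n hn => Finset.mem_image_of_mem window hn]
        refine Finset.sum_congr rfl fun i _ => ?_
        rw [Finset.sum_mul]
        exact Finset.sum_congr rfl fun n hn => by rw [(Finset.mem_filter.1 hn).2]
    _ ≤ ∑ i ∈ s.image window, B * (3 * (1 / (1 + (i : ℝ) ^ 2))) := by
        refine Finset.sum_le_sum fun i _ => mul_le_mul_of_nonneg_right
          (sum_div_le_of_log_mem_Icc ha hC (y := i + x) fun n hn => ?_) (by positivity)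
        obtain ⟨hle, hlt⟩ := Int.floor_eq_iff.1 (Finset.mem_filter.1 hn).2
        constructor <;> linarith
    _ = 3 * B * ∑ i ∈ s.image window, 1 / (1 + (i : ℝ) ^ 2) := by
        rw [Finset.mul_sum]
        exact Finset.sum_congr rfl fun i _ => by ring
    _ ≤ 3 * B * ∑' i : ℤ, 1 / (1 + (i : ℝ) ^ 2) := by
        gcongr
        exact summable_one_div_one_add_int_sq.sum_le_tsum _ fun i _ => by positivity

end Chebyshev

theorem rpow_neg_le_inv (n : ℕ) {σ : ℝ} (hσ : 1 ≤ σ) : (n : ℝ) ^ (-σ) ≤ (n : ℝ)⁻¹ := by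
  rcases Nat.eq_zero_or_pos n with rfl | hn
  · simp [Real.zero_rpow (show -σ ≠ 0 by linarith)]
  · rw [← Real.rpow_neg_one]
    exact Real.rpow_le_rpow_of_exponent_le (Nat.one_le_cast.2 hn) (neg_le_neg hσ)

theorem hasSum_mul_rpow_mul_fejer_le {a : ℕ → ℝ} (ha : ∀ n, 0 ≤ a n) {x K : ℝ}
    (hK : ∀ s : Finset ℕ, ∑ n ∈ s, a n / n / (1 + (x - Real.log n) ^ 2) ≤ K)
    {T η σ S : ℝ} (hT : 0 < T) (hη : 0 < η) (hσ : 1 ≤ σ)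
    (hx : ∀ n, a n ≠ 0 → η ≤ |x - Real.log n|)
    (hS : HasSum (fun n : ℕ => a n * (n : ℝ) ^ (-σ) * fejer T (x - Real.log n)) S) :
    S ≤ 2 / T * (1 + 1 / η ^ 2) * K := by
  refine le_of_tendsto hS (.of_forall fun s => ?_)
  calc ∑ n ∈ s, a n * (n : ℝ) ^ (-σ) * fejer T (x - Real.log n)
      ≤ ∑ n ∈ s, 2 / T * (1 + 1 / η ^ 2) * (a n / n / (1 + (x - Real.log n) ^ 2)) := by
        refine Finset.sum_le_sum fun n _ => ?_
        rcases eq_or_ne (a n) 0 with hn | hn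
        · simp [hn]
        · calc a n * (n : ℝ) ^ (-σ) * fejer T (x - Real.log n)
              ≤ a n * (n : ℝ)⁻¹ * (2 / T * (1 + 1 / η ^ 2) / (1 + (x - Real.log n) ^ 2)) :=
                mul_le_mul (mul_le_mul_of_nonneg_left (rpow_neg_le_inv n hσ) (ha n))
                  (fejer_le_of_le_abs hT hη (hx n hn)) (fejer_nonneg hT _)
                  (mul_nonneg (ha n) (by positivity))
            _ = _ := by ring
    _ = 2 / T * (1 + 1 / η ^ 2) * ∑ n ∈ s, a n / n / (1 + (x - Real.log n) ^ 2) :=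
        (Finset.mul_sum ..).symm
    _ ≤ 2 / T * (1 + 1 / η ^ 2) * K := by
        gcongr
        exact hK s

theorem sub_sub_one_le_card_Icc_ceil_floor {u : ℝ} (hu : 0 ≤ u) (v : ℝ) :
    v - u - 1 ≤ ((Finset.Icc ⌈u⌉₊ ⌊v⌋₊).card : ℝ) := by
  have hfloor := Nat.lt_floor_add_one v
  have hceil := Nat.ceil_lt_add_one hu
  have hsub : ((⌊v⌋₊ + 1 : ℕ) : ℝ) ≤ ((⌊v⌋₊ + 1 - ⌈u⌉₊ : ℕ) : ℝ) + (⌈u⌉₊ : ℝ) :=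
    mod_cast le_tsub_add
  rw [Nat.card_Icc]
  push_cast at hsub
  linarith

theorem le_hasSum_rpow_mul_fejer {T : ℝ} (hT : 0 < T) {x σ S : ℝ} (hσ : 0 ≤ σ)
    (hS : HasSum (fun n : ℕ => (n : ℝ) ^ (-σ) * fejer T (x - Real.log n)) S) :
    (Real.exp (x + 1 / T) - Real.exp x - 1) * (Real.exp (x + 1 / T) ^ (-σ) * (T / 4)) ≤ S := by
  set u := Real.exp x
  set v := Real.exp (x + 1 / T)
  have hv : 0 < v := Real.exp_pos _
  calc (v - u - 1) * (v ^ (-σ) * (T / 4))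
      ≤ ((Finset.Icc ⌈u⌉₊ ⌊v⌋₊).card : ℝ) * (v ^ (-σ) * (T / 4)) := by
        gcongr
        exact sub_sub_one_le_card_Icc_ceil_floor (Real.exp_pos x).le v
    _ = ∑ n ∈ Finset.Icc ⌈u⌉₊ ⌊v⌋₊, v ^ (-σ) * (T / 4) := by simp
    _ ≤ ∑ n ∈ Finset.Icc ⌈u⌉₊ ⌊v⌋₊, (n : ℝ) ^ (-σ) * fejer T (x - Real.log n) := by
        refine Finset.sum_le_sum fun n hn => ?_
        obtain ⟨hceil, hfloor⟩ := Finset.mem_Icc.1 hn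
        have hun : u ≤ n := Nat.ceil_le.1 hceil
        have hnv : (n : ℝ) ≤ v := (Nat.le_floor_iff hv.le).1 hfloor
        have hn0 : (0 : ℝ) < n := (Real.exp_pos x).trans_le hun
        have hlog_ge : x ≤ Real.log n := (Real.le_log_iff_exp_le hn0).2 hun
        have hlog_le : Real.log n ≤ x + 1 / T := (Real.log_le_iff_le_exp hn0).2 hnv
        refine mul_le_mul (Real.rpow_le_rpow_of_nonpos hn0 hnv (neg_nonpos.2 hσ))
          (le_fejer_of_abs_mul_le_one hT ?_) (by positivity) (by positivity)
        rw [abs_mul, abs_of_pos hT, abs_of_nonpos (by linarith), mul_comm, ← le_div_iff₀ hT]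
        linarith
    _ ≤ S := sum_le_hasSum _ (fun n _ => mul_nonneg (by positivity) (fejer_nonneg hT _)) hS

theorem one_div_eight_sub_le {T : ℝ} (hT : 1 ≤ T) (x : ℝ) :
    1 / 8 - T / 4 * Real.exp (-x) ≤ (Real.exp (x + 1 / T) - Real.exp x - 1) *
      (Real.exp (x + 1 / T) ^ (-1 : ℝ) * (T / 4)) := by
  have : 0 < T := by linarith
  set q := Real.exp (-(1 / T)) with hq
  have hq0 : 0 < q := Real.exp_pos _
  have hq1 : q ≤ 1 := Real.exp_le_one_iff.2 (neg_nonpos.2 (by positivity))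
  have hqT : q * (T + 1) ≤ T := by
    have hexp : q * Real.exp (1 / T) = 1 := by
      rw [hq, ← Real.exp_add, neg_add_cancel, Real.exp_zero]
    calc q * (T + 1) = T * (q * (1 / T + 1)) := by field_simp; ring
      _ ≤ T * (q * Real.exp (1 / T)) := by gcongr; exact Real.add_one_le_exp _
      _ = T := by rw [hexp, mul_one]
  have hrhs : (Real.exp (x + 1 / T) - Real.exp x - 1) *
      (Real.exp (x + 1 / T) ^ (-1 : ℝ) * (T / 4)) =
        (1 - q) * T / 4 - T / 4 * (Real.exp (-x) * q) := by
    rw [Real.rpow_neg_one, hq, Real.exp_add, Real.exp_neg, Real.exp_neg]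
    have := Real.exp_pos x
    have := Real.exp_pos (1 / T)
    field_simp
  have hlast : T / 4 * (Real.exp (-x) * q) ≤ T / 4 * Real.exp (-x) := by
    gcongr
    exact mul_le_of_le_one_right (Real.exp_pos _).le hq1
  rw [hrhs]
  nlinarith

section NonnegCoefficients

variable {a : ℕ → ℝ} (ha : ∀ n, 0 ≤ a n) {H : ℂ → ℂ} (hH : ContinuousOn H {s | 1 ≤ s.re})
  (hL : ∀ s : ℂ, 1 < s.re → LSeriesHasSum (fun n => (a n : ℂ) - 1) s (H s))
include ha hH hL

theorem add_re_triangleIntegral_le {x K : ℝ}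
    (hK : ∀ s : Finset ℕ, ∑ n ∈ s, a n / n / (1 + (x - Real.log n) ^ 2) ≤ K)
    {T η : ℝ} (hT : 1 ≤ T) (hη : 0 < η) (hx : ∀ n, a n ≠ 0 → η ≤ |x - Real.log n|) :
    1 / 8 - T / 4 * Real.exp (-x) +
        (triangleIntegral T (fun t => H ((1 : ℝ) + Complex.I * t)) x).re ≤
      2 / T * (1 + 1 / η ^ 2) * K := by
  have hT0 : 0 < T := by linarith
  set v := Real.exp (x + 1 / T)
  refine (add_le_add_left (one_div_eight_sub_le hT x) _).trans ?_
  have hlim : Tendsto (fun σ : ℝ => (v - Real.exp x - 1) * (v ^ (-σ) * (T / 4)) +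
      (triangleIntegral T (fun t => H (σ + Complex.I * t)) x).re) (𝓝[>] 1)
      (𝓝 ((v - Real.exp x - 1) * (v ^ (-1 : ℝ) * (T / 4)) +
        (triangleIntegral T (fun t => H ((1 : ℝ) + Complex.I * t)) x).re)) := by
    refine Tendsto.add (Tendsto.const_mul _ (Tendsto.mul_const _ ?_))
      ((Complex.continuous_re.tendsto _).comp (tendsto_triangleIntegral_verticalLine hH T x))
    have hcont : Continuous fun σ : ℝ => v ^ (-σ) :=
      continuous_const.rpow continuous_neg fun _ => .inl (Real.exp_pos _).ne'
    exact (hcont.tendsto 1).mono_left nhdsWithin_le_nhds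
  refine le_of_tendsto hlim ?_
  filter_upwards [self_mem_nhdsWithin] with σ (hσ : 1 < σ)
  have hre (t : ℝ) : 1 < ((σ : ℂ) + Complex.I * t).re := by simpa using hσ
  have hsub := hasSum_mul_fejer hT0.le (a := fun n => a n - 1) (by linarith : σ ≠ 0)
    (fun t => by simpa using hL _ (hre t)) x
  have hone := hasSum_mul_fejer hT0.le (a := fun _ => 1) (by linarith : σ ≠ 0)
    (fun t => by simp only [Complex.ofReal_one]; exact LSeriesHasSum_one (hre t)) x
  have hlower :=
    le_hasSum_rpow_mul_fejer hT0 (by linarith : 0 ≤ σ) (by simpa only [one_mul] using hone)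
  have hupper := hasSum_mul_rpow_mul_fejer_le ha hK hT0 hη hσ.le hx
    ((hone.add hsub).congr_fun fun n => by ring)
  linarith

theorem eventually_exists_ne_zero_log_near {C : ℝ}
    (hC : ∀ x : ℝ, 0 ≤ x → ∑ n ∈ Finset.Ioc 0 ⌊x⌋₊, a n ≤ C * x) {η : ℝ} (hη : 0 < η) :
    ∀ᶠ x : ℝ in atTop, ∃ n, a n ≠ 0 ∧ |x - Real.log n| < η := by
  obtain ⟨K, hK⟩ := exists_sum_div_one_add_sq_le ha hC
  set D : ℝ := (1 + 1 / η ^ 2) * K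
  set T : ℝ := max 1 (32 * D)
  have hT : 1 ≤ T := le_max_left _ _
  have hT0 : 0 < T := by linarith
  have hmain : 2 / T * (1 + 1 / η ^ 2) * K ≤ 1 / 16 := by
    rw [mul_assoc, div_mul_eq_mul_div, div_le_iff₀ hT0]
    linarith [le_max_right 1 (32 * D)]
  have hexp : Tendsto (fun x : ℝ => T / 4 * Real.exp (-x)) atTop (𝓝 0) := by
    simpa using Real.tendsto_exp_neg_atTop_nhds_zero.const_mul (T / 4)
  have hosc : Tendsto (fun x : ℝ =>
      (triangleIntegral T (fun t => H ((1 : ℝ) + Complex.I * t)) x).re) atTop (𝓝 0) :=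
    (Complex.continuous_re.tendsto 0).comp (tendsto_triangleIntegral_atTop hT0.le _)
  filter_upwards [hexp.eventually_lt_const (show (0 : ℝ) < 1 / 64 by norm_num),
    hosc.eventually_const_lt (show -(1 / 64 : ℝ) < 0 by norm_num)] with x hx_exp hx_osc
  by_contra! hfar
  have := add_re_triangleIntegral_le ha hH hL (hK x) hT hη hfar
  linarith

end NonnegCoefficients

end Tauberian

section Primes

/-- The function equal to `log p` at each prime `p` and to `0` elsewhere, whose summatory function
is Chebyshev's `θ`. -/
def primeLog (n : ℕ) : ℝ := if n.Prime then Real.log n else 0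

theorem primeLog_nonneg (n : ℕ) : 0 ≤ primeLog n := by
  rw [primeLog]
  split_ifs
  exacts [Real.log_natCast_nonneg n, le_rfl]

theorem prime_of_primeLog_ne_zero {n : ℕ} (hn : primeLog n ≠ 0) : n.Prime :=
  of_not_not fun h => hn (if_neg h)

theorem sum_primeLog_le {x : ℝ} (hx : 0 ≤ x) :
    ∑ n ∈ Finset.Ioc 0 ⌊x⌋₊, primeLog n ≤ Real.log 4 * x := by
  simp only [primeLog, ← Finset.sum_filter]
  exact Chebyshev.theta_le_log4_mul_x hx

theorem residueClass_zmod_one :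
    vonMangoldt.residueClass (1 : ZMod 1) = fun n => vonMangoldt n :=
  funext fun _ =>
    Set.indicator_of_mem (s := {n : ℕ | (n : ZMod 1) = 1}) (Subsingleton.elim _ _) _

theorem exists_continuous_eq_riemannZeta_sub :
    ∃ Z : ℂ → ℂ, Continuous Z ∧ ∀ s ≠ 1, Z s = riemannZeta s - 1 / (s - 1) := by
  classical
  refine ⟨Function.update (fun s => riemannZeta s - 1 / (s - 1)) 1 Real.eulerMascheroniConstant,
    continuous_iff_continuousAt.2 fun s => ?_, fun s hs => Function.update_of_ne hs _ _⟩
  rcases eq_or_ne s 1 with rfl | hs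
  · exact continuousAt_update_same.2 tendsto_riemannZeta_sub_one_div
  · rw [continuousAt_update_of_ne hs]
    exact (differentiableAt_riemannZeta hs).continuousAt.sub
      (continuousAt_const.div (continuousAt_id.sub continuousAt_const) (sub_ne_zero.2 hs))

-- This is where the non-vanishing of `ζ` on the line `re s = 1` enters.
theorem exists_continuousOn_eq_LSeries_vonMangoldt_sub :
    ∃ V : ℂ → ℂ, ContinuousOn V {s | 1 ≤ s.re} ∧
      ∀ s : ℂ, 1 < s.re → V s = LSeries (fun n => (vonMangoldt n : ℂ)) s - 1 / (s - 1) := by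
  refine ⟨vonMangoldt.LFunctionResidueClassAux (1 : ZMod 1),
    vonMangoldt.continuousOn_LFunctionResidueClassAux _, fun s hs => ?_⟩
  simpa [residueClass_zmod_one] using
    vonMangoldt.eqOn_LFunctionResidueClassAux (q := 1) (a := 1) isUnit_one hs

theorem LSeriesSummable_vonMangoldt_sub_primeLog :
    LSeriesSummable (fun n => (vonMangoldt n : ℂ) - primeLog n) (1 : ℝ) := by
  have hsummable := vonMangoldt.summable_residueClass_non_primes_div (1 : ZMod 1)
  rw [residueClass_zmod_one] at hsummable
  refine (Complex.hasSum_ofReal.2 hsummable.hasSum).summable.congr fun n => ?_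
  rcases eq_or_ne n 0 with rfl | hn
  · simp
  rw [LSeries.term_of_ne_zero hn, Complex.ofReal_one, Complex.cpow_one, primeLog]
  split_ifs with hp
  · simp [vonMangoldt_apply_prime hp]
  · simp

theorem exists_continuousOn_LSeriesHasSum_primeLog_sub_one :
    ∃ H : ℂ → ℂ, ContinuousOn H {s | 1 ≤ s.re} ∧
      ∀ s : ℂ, 1 < s.re → LSeriesHasSum (fun n => (primeLog n : ℂ) - 1) s (H s) := by
  obtain ⟨Z, hZ, hZs⟩ := exists_continuous_eq_riemannZeta_sub
  obtain ⟨V, hV, hVs⟩ := exists_continuousOn_eq_LSeries_vonMangoldt_sub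
  have hprimePowers := LSeriesSummable_vonMangoldt_sub_primeLog
  refine ⟨fun s => V s - LSeries (fun n => (vonMangoldt n : ℂ) - primeLog n) s - Z s,
    (hV.sub (continuousOn_LSeries_of_LSeriesSummable hprimePowers)).sub hZ.continuousOn,
    fun s hs => ?_⟩
  have hs1 : s ≠ 1 := by rintro rfl; simp at hs
  have hpp := (hprimePowers.of_re_le_re (s' := s) (by simpa using hs.le)).LSeriesHasSum
  have hΛ := (ArithmeticFunction.LSeriesSummable_vonMangoldt hs).LSeriesHasSum
  convert (hΛ.sub hpp).sub (LSeriesHasSum_one hs) using 1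
  · ext n
    simp
  · beta_reduce
    rw [hVs s hs, hZs s hs1]
    ring

theorem eventually_exists_prime_mem_Icc {ε : ℝ} (hε : 0 < ε) :
    ∀ᶠ x : ℝ in atTop, ∃ p : ℕ, p.Prime ∧ (p : ℝ) ∈ Set.Icc x ((1 + ε) * x) := by
  obtain ⟨H, hH, hL⟩ := exists_continuousOn_LSeriesHasSum_primeLog_sub_one
  set η : ℝ := Real.log (1 + ε) / 2
  have hη : 0 < η := half_pos (Real.log_pos (by linarith))
  have hlog : η + η = Real.log (1 + ε) := add_halves _
  have hmid : Tendsto (fun x : ℝ => Real.log x + η) atTop atTop :=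
    tendsto_atTop_add_const_right _ _ Real.tendsto_log_atTop
  filter_upwards [hmid.eventually (eventually_exists_ne_zero_log_near primeLog_nonneg hH hL
    (fun _ => sum_primeLog_le) hη), eventually_gt_atTop 0] with x ⟨p, hp, hxp⟩ hx
  have hp := prime_of_primeLog_ne_zero hp
  have hp0 : (0 : ℝ) < p := Nat.cast_pos.2 hp.pos
  rw [abs_lt] at hxp
  refine ⟨p, hp, ?_, ?_⟩
  · rw [← Real.log_le_log_iff hx hp0]
    linarith
  · rw [← Real.log_le_log_iff hp0 (by positivity), Real.log_mul (by positivity) hx.ne']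
    linarith

theorem prime_primeCeil_and_le (x : ℝ) : (primeCeil x).Prime ∧ x ≤ primeCeil x := by
  refine Nat.sInf_mem (s := {p : ℕ | p.Prime ∧ x ≤ p}) ?_
  obtain ⟨p, hp, hpp⟩ := Nat.exists_infinite_primes ⌈x⌉₊
  exact ⟨p, hpp, Nat.ceil_le.1 hp⟩

theorem prime_primeCeil (x : ℝ) : (primeCeil x).Prime := (prime_primeCeil_and_le x).1

theorem le_primeCeil (x : ℝ) : x ≤ primeCeil x := (prime_primeCeil_and_le x).2

theorem primeCeil_le {x : ℝ} {p : ℕ} (hp : p.Prime) (hx : x ≤ p) : primeCeil x ≤ p :=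
  Nat.sInf_le (s := {p : ℕ | p.Prime ∧ x ≤ p}) ⟨hp, hx⟩

theorem tendsto_primeCeil_div : Tendsto (fun x : ℝ => (primeCeil x : ℝ) / x) atTop (𝓝 1) := by
  refine tendsto_order.2 ⟨fun a ha => ?_, fun a ha => ?_⟩
  · filter_upwards [eventually_gt_atTop 0] with x hx
    exact ha.trans_le ((one_le_div hx).2 (le_primeCeil x))
  · filter_upwards [eventually_gt_atTop 0,
      eventually_exists_prime_mem_Icc (show 0 < (a - 1) / 2 by linarith)]
    with x hx ⟨p, hp, hxp, hpx⟩
    have hle : (primeCeil x : ℝ) ≤ p := Nat.cast_le.2 (primeCeil_le hp hxp)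
    rw [div_lt_iff₀ hx]
    nlinarith

end Primes

section Totient

theorem totient_div_eq_sum_moebius {N : ℕ} (hN : 0 < N) :
    (N.totient : ℝ) / N = ∑ d ∈ N.divisors, (moebius d : ℝ) / d := by
  have hinv := (sum_eq_iff_sum_mul_moebius_eq (R := ℝ) (f := fun n => (n.totient : ℝ))
    (g := fun n => (n : ℝ))).1 (fun n _ => mod_cast Nat.sum_totient n) N hN
  have hN0 : (N : ℝ) ≠ 0 := Nat.cast_ne_zero.2 hN.ne'
  rw [← hinv, Nat.sum_divisorsAntidiagonal (fun a b => (moebius a : ℝ) * (b : ℝ)),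
    Finset.sum_div]
  refine Finset.sum_congr rfl fun d hd => ?_
  have hd0 : (d : ℝ) ≠ 0 := Nat.cast_ne_zero.2 (Nat.pos_of_mem_divisors hd).ne'
  rw [Nat.cast_div (Nat.dvd_of_mem_divisors hd) hd0]
  field_simp

theorem sum_totient_div_eq_sum_moebius_mul_card {s : Finset ℕ} {M : ℕ}
    (hs : ∀ N ∈ s, N ∈ Set.Icc 1 M) :
    ∑ N ∈ s, (N.totient : ℝ) / N =
      ∑ d ∈ Finset.range (M + 1), (moebius d : ℝ) / d * ((s.filter (d ∣ ·)).card : ℝ) := by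
  have htotient : ∀ N ∈ s, (N.totient : ℝ) / N =
      ∑ d ∈ Finset.range (M + 1), if d ∣ N then (moebius d : ℝ) / d else 0 := by
    intro N hN
    obtain ⟨hN1, hNM⟩ := hs N hN
    rw [totient_div_eq_sum_moebius hN1, ← Finset.sum_filter]
    refine Finset.sum_congr (Finset.ext fun d => ?_) fun _ _ => rfl
    simp only [Nat.mem_divisors, Finset.mem_filter, Finset.mem_range]
    exact ⟨fun h => ⟨Nat.lt_succ_of_le ((Nat.le_of_dvd hN1 h.1).trans hNM), h.1⟩,
      fun h => ⟨h.2, Nat.one_le_iff_ne_zero.1 hN1⟩⟩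
  rw [Finset.sum_congr rfl htotient, Finset.sum_comm]
  refine Finset.sum_congr rfl fun d _ => ?_
  rw [← Finset.sum_filter, Finset.sum_const, nsmul_eq_mul, mul_comm]

theorem sum_range_succ_one_div_le (M : ℕ) :
    ∑ d ∈ Finset.range (M + 1), 1 / (d : ℝ) ≤ 1 + Real.log M := by
  refine le_of_eq_of_le ?_ (harmonic_le_one_add_log M)
  rw [harmonic, Finset.sum_range_succ']
  simp

theorem abs_sum_totient_div_sub_le {s : Finset ℕ} {M : ℕ} (hs : ∀ N ∈ s, N ∈ Set.Icc 1 M)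
    {ρ : ℕ → ℝ} {L C : ℝ}
    (hρ : ∀ d, 0 < d → |((s.filter (d ∣ ·)).card : ℝ) - L * ρ d| ≤ C) :
    |∑ N ∈ s, (N.totient : ℝ) / N - L * ∑ d ∈ Finset.range (M + 1), (moebius d : ℝ) / d * ρ d| ≤
      C * (1 + Real.log M) := by
  have hC : 0 ≤ C := (abs_nonneg _).trans (hρ 1 one_pos)
  rw [sum_totient_div_eq_sum_moebius_mul_card hs, Finset.mul_sum, ← Finset.sum_sub_distrib]
  calc _ ≤ ∑ d ∈ Finset.range (M + 1), C * (1 / (d : ℝ)) := by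
        refine (Finset.abs_sum_le_sum_abs _ _).trans (Finset.sum_le_sum fun d _ => ?_)
        rcases Nat.eq_zero_or_pos d with rfl | hd
        · simp
        have hμ : |(moebius d : ℝ)| ≤ 1 := mod_cast abs_moebius_le_one (n := d)
        have hfactor : (moebius d : ℝ) / d * ((s.filter (d ∣ ·)).card : ℝ) -
            L * ((moebius d : ℝ) / d * ρ d) =
              (moebius d : ℝ) * (((s.filter (d ∣ ·)).card : ℝ) - L * ρ d) * (1 / d) := by ring
        rw [hfactor, abs_mul, abs_mul, abs_of_nonneg (show 0 ≤ 1 / (d : ℝ) by positivity)]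
        gcongr
        exact (mul_le_of_le_one_left (abs_nonneg _) hμ).trans (hρ d hd)
    _ ≤ C * (1 + Real.log M) := by
        rw [← Finset.mul_sum]
        gcongr
        exact sum_range_succ_one_div_le M

theorem hasSum_moebius_div_sq :
    HasSum (fun n : ℕ => (moebius n : ℝ) / (n : ℝ) ^ 2) (6 / Real.pi ^ 2) := by
  have hs : 1 < (2 : ℂ).re := by norm_num
  have hvalue : LSeries (fun n => ((moebius n : ℤ) : ℂ)) 2 = ((6 / Real.pi ^ 2 : ℝ) : ℂ) := by
    have hinv := LSeries_one_mul_Lseries_moebius hs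
    rw [LSeries_one_eq_riemannZeta hs, riemannZeta_two] at hinv
    have hpi : (Real.pi : ℂ) ≠ 0 := Complex.ofReal_ne_zero.2 Real.pi_ne_zero
    push_cast
    field_simp at hinv ⊢
    linear_combination hinv
  have hsum := (LSeriesSummable_moebius_iff.2 hs).LSeriesHasSum
  rw [hvalue, LSeriesHasSum] at hsum
  refine Complex.hasSum_ofReal.1 (hsum.congr_fun fun n => ?_)
  rcases eq_or_ne n 0 with rfl | hn
  · simp
  · rw [LSeries.term_of_ne_zero hn]
    push_cast
    norm_cast

theorem moebius_two_mul_odd (j : ℕ) : moebius (2 * (2 * j + 1)) = -moebius (2 * j + 1) := by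
  rw [isMultiplicative_moebius.map_mul_of_coprime (by simp), moebius_apply_prime Nat.prime_two,
    neg_one_mul]

theorem moebius_two_mul_two_mul (j : ℕ) : moebius (2 * (2 * j)) = 0 :=
  moebius_eq_zero_of_not_squarefree fun h => by simpa using h 2 ⟨j, by ring⟩

theorem hasSum_moebius_div_sq_even {A : ℝ}
    (hodd : HasSum (fun j : ℕ => (moebius (2 * j + 1) : ℝ) / ((2 * j + 1 : ℕ) : ℝ) ^ 2) A) :
    HasSum (fun k : ℕ => (moebius (2 * k) : ℝ) / ((2 * k : ℕ) : ℝ) ^ 2) (-(1 / 4) * A) := by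
  rw [← zero_add (-(1 / 4) * A)]
  refine HasSum.even_add_odd ?_ ((hodd.mul_left (-(1 / 4))).congr_fun fun j => ?_)
  · simpa only [moebius_two_mul_two_mul, Int.cast_zero, zero_div] using hasSum_zero
  · rw [moebius_two_mul_odd]
    push_cast
    field_simp
    norm_num

theorem hasSum_moebius_div_sq_odd :
    HasSum (fun j : ℕ => (moebius (2 * j + 1) : ℝ) / ((2 * j + 1 : ℕ) : ℝ) ^ 2)
      (8 / Real.pi ^ 2) := by
  have hsummable :
      Summable fun j : ℕ => (moebius (2 * j + 1) : ℝ) / ((2 * j + 1 : ℕ) : ℝ) ^ 2 :=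
    hasSum_moebius_div_sq.summable.comp_injective
      (i := fun j : ℕ => 2 * j + 1) fun _ _ h => by simpa using h
  have hodd := hsummable.hasSum
  set A := ∑' j : ℕ, (moebius (2 * j + 1) : ℝ) / ((2 * j + 1 : ℕ) : ℝ) ^ 2
  have htotal : -(1 / 4) * A + A = 6 / Real.pi ^ 2 :=
    (HasSum.even_add_odd (f := fun n : ℕ => (moebius n : ℝ) / (n : ℝ) ^ 2)
      (hasSum_moebius_div_sq_even hodd) hodd).unique hasSum_moebius_div_sq
  rwa [show 8 / Real.pi ^ 2 = A by linear_combination -(4 / 3) * htotal]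

/-- The density of the multiples `N` of `d` with `N ≢ 2 mod 4`, by inclusion-exclusion. -/
def multipleDensity (d : ℕ) : ℝ := 1 / d - 1 / (d.lcm 2 : ℕ) + 1 / (d.lcm 4 : ℕ)

theorem multipleDensity_odd (j : ℕ) :
    multipleDensity (2 * j + 1) = 3 / 4 * (1 / (2 * j + 1 : ℕ)) := by
  have h2 : (2 * j + 1).Coprime 2 := by simp
  have h4 : (2 * j + 1).Coprime 4 := h2.pow_right 2
  rw [multipleDensity, h2.lcm_eq_mul, h4.lcm_eq_mul]
  push_cast
  field_simp
  norm_num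

theorem multipleDensity_two_mul_odd (j : ℕ) :
    multipleDensity (2 * (2 * j + 1)) = 1 / 2 * (1 / (2 * (2 * j + 1) : ℕ)) := by
  have hcoprime : (2 * j + 1).Coprime 2 := by simp
  have hlcm4 : (2 * (2 * j + 1)).lcm 4 = 2 * ((2 * j + 1) * 2) := by
    rw [show 4 = 2 * 2 from rfl, Nat.lcm_mul_left, hcoprime.lcm_eq_mul]
  have hlcm2 : (2 * (2 * j + 1)).lcm 2 = 2 * (2 * j + 1) := Nat.lcm_eq_left ⟨_, rfl⟩
  rw [multipleDensity, hlcm4, hlcm2]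
  push_cast
  field_simp
  norm_num

theorem hasSum_moebius_mul_multipleDensity :
    HasSum (fun d : ℕ => (moebius d : ℝ) / d * multipleDensity d) (5 / Real.pi ^ 2) := by
  have hvalue : 5 / Real.pi ^ 2 =
      1 / 2 * (-(1 / 4) * (8 / Real.pi ^ 2)) + 3 / 4 * (8 / Real.pi ^ 2) := by ring
  rw [hvalue]
  refine HasSum.even_add_odd ?_ ?_
  · have heven := hasSum_moebius_div_sq_even hasSum_moebius_div_sq_odd
    refine (heven.mul_left (1 / 2)).congr_fun fun k => ?_
    rcases Nat.even_or_odd' k with ⟨j, rfl | rfl⟩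
    · simp [moebius_two_mul_two_mul]
    · rw [multipleDensity_two_mul_odd]
      field_simp
  · refine (hasSum_moebius_div_sq_odd.mul_left (3 / 4)).congr_fun fun k => ?_
    rw [multipleDensity_odd]
    field_simp

theorem filter_dvd_Icc_ceil_floor {a b : ℝ} (hb : 0 ≤ b) {m : ℕ} (hm : 0 < m) :
    (Finset.Icc ⌈a⌉₊ ⌊b⌋₊).filter (m ∣ ·) =
      (Finset.Icc ⌈a / m⌉₊ ⌊b / m⌋₊).image (m * ·) := by
  have hm0 : (0 : ℝ) < m := Nat.cast_pos.2 hm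
  ext n
  simp only [Finset.mem_filter, Finset.mem_Icc, Finset.mem_image, Nat.ceil_le,
    Nat.le_floor_iff hb, Nat.le_floor_iff (div_nonneg hb hm0.le), div_le_iff₀ hm0,
    le_div_iff₀ hm0]
  constructor
  · rintro ⟨⟨han, hnb⟩, k, rfl⟩
    push_cast at han hnb
    exact ⟨k, ⟨by linarith, by linarith⟩, rfl⟩
  · rintro ⟨k, ⟨hak, hkb⟩, rfl⟩
    push_cast
    exact ⟨⟨by linarith, by linarith⟩, dvd_mul_right _ _⟩

theorem abs_card_Icc_ceil_floor_sub_le {u v : ℝ} (hu : 0 ≤ u) (huv : u ≤ v) :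
    |((Finset.Icc ⌈u⌉₊ ⌊v⌋₊).card : ℝ) - (v - u)| ≤ 1 := by
  have hfloor := Nat.floor_le (hu.trans huv)
  have hceil := Nat.le_ceil u
  have hle : ⌈u⌉₊ ≤ ⌊v⌋₊ + 1 :=
    Nat.ceil_le.2 (by push_cast; linarith [Nat.lt_floor_add_one v])
  have hlower := sub_sub_one_le_card_Icc_ceil_floor hu v
  rw [Nat.card_Icc, Nat.cast_sub hle] at *
  push_cast at *
  rw [abs_le]
  constructor <;> linarith

theorem abs_card_filter_dvd_sub_le {a b : ℝ} (ha : 0 ≤ a) (hab : a ≤ b) {m : ℕ} (hm : 0 < m) :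
    |(((Finset.Icc ⌈a⌉₊ ⌊b⌋₊).filter (m ∣ ·)).card : ℝ) - (b - a) * (1 / m)| ≤ 1 := by
  rw [filter_dvd_Icc_ceil_floor (ha.trans hab) hm, Finset.card_image_of_injective _
    fun _ _ h => Nat.eq_of_mul_eq_mul_left hm h, mul_one_div, sub_div]
  exact abs_card_Icc_ceil_floor_sub_le (by positivity) (by gcongr)

theorem card_filter_not_modEq_two_dvd (s : Finset ℕ) (d : ℕ) :
    (((s.filter fun N => ¬ N ≡ 2 [MOD 4]).filter (d ∣ ·)).card : ℝ) =
      ((s.filter (d ∣ ·)).card : ℝ) - ((s.filter (d.lcm 2 ∣ ·)).card : ℝ) +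
        ((s.filter (d.lcm 4 ∣ ·)).card : ℝ) := by
  rw [Finset.filter_filter]
  simp only [Finset.card_filter, Nat.cast_sum, ← Finset.sum_sub_distrib, ← Finset.sum_add_distrib]
  refine Finset.sum_congr rfl fun n _ => ?_
  have hmod : n ≡ 2 [MOD 4] ↔ 2 ∣ n ∧ ¬ 4 ∣ n := by rw [Nat.ModEq]; omega
  have h42 : 4 ∣ n → 2 ∣ n := (by norm_num : 2 ∣ 4).trans
  simp only [Nat.lcm_dvd_iff, hmod]
  by_cases hd : d ∣ n <;> by_cases h4 : 4 ∣ n <;> by_cases h2 : 2 ∣ n <;>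
    first | exact absurd (h42 h4) h2 | simp [hd, h4, h2]

theorem abs_card_shortConductors_dvd_sub_le {X δ : ℝ} (hX : 0 ≤ X) {d : ℕ} (hd : 0 < d) :
    |(((shortConductors X δ).filter (d ∣ ·)).card : ℝ) - X ^ δ * multipleDensity d| ≤ 3 := by
  have hle : X ≤ X + X ^ δ := le_add_of_nonneg_right (Real.rpow_nonneg hX δ)
  have h1 := abs_card_filter_dvd_sub_le hX hle hd
  have h2 := abs_card_filter_dvd_sub_le hX hle (Nat.lcm_pos hd two_pos)
  have h4 := abs_card_filter_dvd_sub_le hX hle (Nat.lcm_pos hd four_pos)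
  rw [add_sub_cancel_left, abs_le] at h1 h2 h4
  rw [shortConductors, card_filter_not_modEq_two_dvd, multipleDensity, abs_le]
  constructor <;> linarith

theorem mem_shortConductors_bounds {X δ : ℝ} (hX : 0 < X) {N : ℕ}
    (hN : N ∈ shortConductors X δ) : X ≤ N ∧ (N : ℝ) ≤ X + X ^ δ := by
  rw [shortConductors, Finset.mem_filter, Finset.mem_Icc, Nat.ceil_le,
    Nat.le_floor_iff (by positivity)] at hN
  exact hN.1

theorem abs_average_totient_div_sub_le {X δ : ℝ} (hX : 1 ≤ X) (hδ : δ ≤ 1) :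
    |1 / X ^ δ * ∑ N ∈ shortConductors X δ, (N.totient : ℝ) / N -
        ∑ d ∈ Finset.range (⌊X + X ^ δ⌋₊ + 1), (moebius d : ℝ) / d * multipleDensity d| ≤
      3 * (1 + Real.log 2 + Real.log X) / X ^ δ := by
  have hX0 : 0 < X := by linarith
  have hL : 0 < X ^ δ := Real.rpow_pos_of_pos hX0 _
  have hLX : X ^ δ ≤ X := Real.rpow_le_self_of_one_le hX hδ
  set M := ⌊X + X ^ δ⌋₊
  set R := ∑ d ∈ Finset.range (M + 1), (moebius d : ℝ) / d * multipleDensity d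
  set S := ∑ N ∈ shortConductors X δ, (N.totient : ℝ) / N
  have hM1 : 1 ≤ M := Nat.le_floor (by push_cast; linarith)
  have hlogM : Real.log M ≤ Real.log 2 + Real.log X := by
    rw [← Real.log_mul two_ne_zero hX0.ne']
    exact Real.log_le_log (Nat.cast_pos.2 hM1)
      ((Nat.floor_le (by linarith)).trans (by linarith))
  have hmem : ∀ N ∈ shortConductors X δ, N ∈ Set.Icc 1 M := fun N hN =>
    have ⟨hXN, hNX⟩ := mem_shortConductors_bounds hX0 hN
    ⟨Nat.one_le_cast.1 (hX.trans hXN), Nat.le_floor hNX⟩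
  have hsum : |S - X ^ δ * R| ≤ 3 * (1 + Real.log M) :=
    abs_sum_totient_div_sub_le hmem fun d => abs_card_shortConductors_dvd_sub_le hX0.le
  calc |1 / X ^ δ * S - R| = |(S - X ^ δ * R) / X ^ δ| := by field_simp
    _ = |S - X ^ δ * R| / X ^ δ := by rw [abs_div, abs_of_pos hL]
    _ ≤ 3 * (1 + Real.log 2 + Real.log X) / X ^ δ := by gcongr; linarith

theorem tendsto_average_totient_div {δ : ℝ} (hδ : δ ∈ Set.Ioo (0 : ℝ) 1) :
    Tendsto (fun X : ℝ => 1 / X ^ δ * ∑ N ∈ shortConductors X δ, (N.totient : ℝ) / N) atTop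
      (𝓝 (5 / Real.pi ^ 2)) := by
  have hM : Tendsto (fun X : ℝ => ⌊X + X ^ δ⌋₊ + 1) atTop atTop := by
    refine tendsto_atTop_mono' _ ?_ tendsto_nat_floor_atTop
    filter_upwards [eventually_ge_atTop 0] with X hX
    exact (Nat.floor_mono (le_add_of_nonneg_right (Real.rpow_nonneg hX δ))).trans (Nat.le_succ _)
  have herr : Tendsto (fun X : ℝ => 3 * (1 + Real.log 2 + Real.log X) / X ^ δ) atTop (𝓝 0) := by
    have hlim := (((tendsto_rpow_neg_atTop hδ.1).const_mul (1 + Real.log 2)).add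
      (isLittleO_log_rpow_atTop hδ.1).tendsto_div_nhds_zero).const_mul 3
    simp only [mul_zero, add_zero] at hlim
    refine hlim.congr' ?_
    filter_upwards [eventually_ge_atTop 0] with X hX
    rw [Real.rpow_neg hX]
    ring
  refine tendsto_of_tendsto_of_dist (hasSum_moebius_mul_multipleDensity.tendsto_sum_nat.comp hM)
    (squeeze_zero' (.of_forall fun _ => dist_nonneg) ?_ herr)
  filter_upwards [eventually_ge_atTop 1] with X hX
  rw [dist_comm]
  exact abs_average_totient_div_sub_le hX hδ.2.le

end Totient

section GaussSum

theorem sum_nthRootsFinset {R : Type*} [CommRing R] [IsDomain R] {ζ : R} {n : ℕ}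
    (hζ : IsPrimitiveRoot ζ n) :
    ∑ ξ ∈ Polynomial.nthRootsFinset n (1 : R), ξ = if n = 1 then 1 else 0 := by
  classical
  have hroots : ∑ ξ ∈ Polynomial.nthRootsFinset n (1 : R), ξ =
      ∑ k ∈ Finset.range n, ζ ^ k := by
    rw [Polynomial.nthRootsFinset, ← Multiset.toFinset_eq hζ.nthRoots_one_nodup,
      Finset.sum_mk, hζ.nthRoots_eq (one_pow n)]
    simp only [mul_one, Multiset.map_map, Function.comp_def]
    rfl
  rw [hroots]
  split_ifs with hn
  · simp [hn]
  · rcases Nat.lt_or_gt_of_ne hn with hn0 | hn1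
    · simp [Nat.lt_one_iff.1 hn0]
    · exact hζ.geom_sum_eq_zero hn1

theorem sum_primitiveRoots_eq_moebius {R : Type*} [CommRing R] [IsDomain R] {ζ : R} {n : ℕ}
    (hζ : IsPrimitiveRoot ζ n) (hn : 0 < n) : ∑ ξ ∈ primitiveRoots n R, ξ = moebius n := by
  classical
  have hdivisors : ∀ m > 0, m ∈ {m | m ∣ n} →
      ∑ i ∈ m.divisors, ∑ ξ ∈ primitiveRoots i R, ξ = if m = 1 then 1 else 0 := by
    rintro m - ⟨k, rfl⟩
    rw [← sum_nthRootsFinset (hζ.pow hn (mul_comm m k)),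
      IsPrimitiveRoot.nthRoots_one_eq_biUnion_primitiveRoots,
      Finset.sum_biUnion fun i _ j _ hij => IsPrimitiveRoot.disjoint hij]
  rw [← (sum_eq_iff_sum_mul_moebius_eq_on {m | m ∣ n} fun _ _ hml hl => hml.trans hl).1
    hdivisors n hn dvd_rfl,
    Nat.sum_divisorsAntidiagonal' fun a b => (moebius a : R) * if b = 1 then 1 else 0]
  simp [hn.ne']

variable {N : ℕ}

theorem isPrimitiveRoot_stdAddChar_iff [NeZero N] (b : ZMod N) :
    IsPrimitiveRoot (ZMod.stdAddChar b) N ↔ IsUnit b := by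
  have hζ : IsPrimitiveRoot (ZMod.stdAddChar (1 : ZMod N)) N := by
    convert Complex.isPrimitiveRoot_exp N (NeZero.ne N) using 1
    simpa using ZMod.stdAddChar_coe (N := N) 1
  rw [← ZMod.natCast_zmod_val b, ZMod.isUnit_iff_coprime, ← nsmul_one,
    AddChar.map_nsmul_eq_pow, hζ.pow_iff_coprime (NeZero.pos N)]

theorem image_stdAddChar_filter_isUnit [NeZero N] :
    (Finset.univ.filter fun b : ZMod N => IsUnit b).image ZMod.stdAddChar =
      primitiveRoots N ℂ := by
  ext ξ
  simp only [Finset.mem_image, Finset.mem_filter_univ, mem_primitiveRoots (NeZero.pos N)]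
  constructor
  · rintro ⟨b, hb, rfl⟩
    exact (isPrimitiveRoot_stdAddChar_iff b).2 hb
  · intro hξ
    obtain ⟨k, -, rfl⟩ := ((isPrimitiveRoot_stdAddChar_iff (1 : ZMod N)).2
      isUnit_one).eq_pow_of_pow_eq_one hξ.pow_eq_one
    rw [← AddChar.map_nsmul_eq_pow] at hξ ⊢
    exact ⟨_, (isPrimitiveRoot_stdAddChar_iff _).1 hξ, rfl⟩

theorem tau_one [NeZero N] : tau (1 : DirichletCharacter ℂ N) = moebius N := by
  have hζ := (isPrimitiveRoot_stdAddChar_iff (1 : ZMod N)).2 isUnit_one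
  rw [← sum_primitiveRoots_eq_moebius hζ (NeZero.pos N), ← image_stdAddChar_filter_isUnit,
    Finset.sum_image ZMod.injective_stdAddChar.injOn, Finset.sum_filter, tau_eq_gaussSum,
    gaussSum]
  refine Finset.sum_congr rfl fun b _ => ?_
  split_ifs with hb
  · rw [MulChar.one_apply hb, one_mul]
  · rw [MulChar.map_nonunit _ hb, zero_mul]

theorem norm_tau_one_le [NeZero N] : ‖tau (1 : DirichletCharacter ℂ N)‖ ≤ 1 := by
  rw [tau_one, Complex.norm_intCast]
  exact mod_cast abs_moebius_le_one (n := N)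

theorem tau_mul_tau_star [NeZero N] {χ : DirichletCharacter ℂ N} (hχ : χ.IsPrimitive) :
    tau χ * tau (star χ) = χ (-1) * N := by
  have hdft : ZMod.dft (χ : ZMod N → ℂ) =
      fun k => gaussSum χ (ZMod.stdAddChar (N := N)) * χ⁻¹ (-k) := by
    ext k
    rw [hχ.fourierTransform_eq_inv_mul_gaussSum, mul_comm]
  have hinversion := congrFun (ZMod.dft_dft (χ : ZMod N → ℂ)) 1
  rw [hdft, ZMod.dft_const_mul (gaussSum χ (ZMod.stdAddChar (N := N)))
    (fun k : ZMod N => χ⁻¹ (-k)), ZMod.dft_comp_neg] at hinversion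
  simp only at hinversion
  rw [DirichletCharacter.fourierTransform_eq_gaussSum_mulShift, neg_neg, AddChar.mulShift_one,
    smul_eq_mul] at hinversion
  rw [tau_eq_gaussSum, tau_eq_gaussSum, MulChar.star_eq_inv, hinversion, mul_comm]

theorem inv_apply_eq_apply_inv (χ : DirichletCharacter ℂ N) {a : ZMod N} (ha : IsUnit a) :
    χ⁻¹ a = χ a⁻¹ := by
  obtain ⟨u, rfl⟩ := ha
  rw [MulChar.inv_apply, Ring.inverse_unit, ZMod.inv_coe_unit]

theorem sum_tau_star_mul_apply [NeZero N] {a : ZMod N} (ha : IsUnit a) :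
    ∑ χ : DirichletCharacter ℂ N, tau (star χ) * χ a = N.totient * ZMod.stdAddChar a := by
  calc ∑ χ : DirichletCharacter ℂ N, tau (star χ) * χ a
      = ∑ χ : DirichletCharacter ℂ N, tau χ * χ a⁻¹ := by
        rw [← Equiv.sum_comp (Equiv.inv (DirichletCharacter ℂ N))]
        simp only [Equiv.inv_apply, MulChar.star_eq_inv, inv_inv, inv_apply_eq_apply_inv _ ha]
    _ = ∑ b : ZMod N, ZMod.stdAddChar b * ∑ χ : DirichletCharacter ℂ N, χ a⁻¹ * χ b := by
        simp only [tau_eq_gaussSum, gaussSum, Finset.sum_mul, Finset.mul_sum]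
        rw [Finset.sum_comm]
        exact Finset.sum_congr rfl fun b _ => Finset.sum_congr rfl fun χ _ => by ring
    _ = N.totient * ZMod.stdAddChar a := by
        simp only [DirichletCharacter.sum_char_inv_mul_char_eq ℂ ha, mul_ite, mul_zero,
          Finset.sum_ite_eq, Finset.mem_univ, if_true]
        exact mul_comm _ _

end GaussSum

section Parity

variable {N : ℕ} (ε : ℤˣ)

theorem intCast_units_mul_self : ((ε : ℤ) : ℂ) * ((ε : ℤ) : ℂ) = 1 := by
  rcases Int.units_eq_one_or ε with rfl | rfl <;> simp

theorem norm_intCast_units : ‖((ε : ℤ) : ℂ)‖ = 1 := by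
  rcases Int.units_eq_one_or ε with rfl | rfl <;> simp

open Classical in
/-- The Dirichlet characters `χ` mod `N` with `χ(-1) = ε`, including the principal one when
`ε = 1`. -/
def charsOfParity (ε : ℤˣ) (N : ℕ) : Finset (DirichletCharacter ℂ N) :=
  Finset.univ.filter fun χ => χ (-1) = ((ε : ℤ) : ℂ)

theorem ite_apply_neg_one_eq (χ : DirichletCharacter ℂ N) (z : ℂ) :
    (if χ (-1) = ((ε : ℤ) : ℂ) then z else 0) = (1 + ((ε : ℤ) : ℂ) * χ (-1)) / 2 * z := by
  have hχ : χ (-1) = 1 ∨ χ (-1) = -1 := χ.even_or_odd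
  rcases Int.units_eq_one_or ε with rfl | rfl <;> rcases hχ with hχ | hχ <;> rw [hχ] <;>
    norm_num

theorem sum_charsOfParity_tau_star_mul_apply [NeZero N] {a : ZMod N} (ha : IsUnit a) :
    ∑ χ ∈ charsOfParity ε N, tau (star χ) * χ a =
      N.totient * ((ZMod.stdAddChar a + ((ε : ℤ) : ℂ) * ZMod.stdAddChar (-a)) / 2) := by
  calc ∑ χ ∈ charsOfParity ε N, tau (star χ) * χ a
      = ∑ χ : DirichletCharacter ℂ N,
          (tau (star χ) * χ a + ((ε : ℤ) : ℂ) * (tau (star χ) * χ (-a))) / 2 := by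
        rw [charsOfParity, Finset.sum_filter]
        refine Finset.sum_congr rfl fun χ _ => ?_
        rw [ite_apply_neg_one_eq, ← neg_one_mul a, map_mul]
        ring
    _ = _ := by
        rw [← Finset.sum_div, Finset.sum_add_distrib, ← Finset.mul_sum,
          sum_tau_star_mul_apply ha, sum_tau_star_mul_apply ha.neg]
        ring

/-- `ε (e(t) + ε e(-t)) / 2`, which is `cos (2πt)` for `ε = 1` and `-i sin (2πt)` for `ε = -1`. -/
def wave (ε : ℤˣ) (t : ℝ) : ℂ :=
  ((ε : ℤ) : ℂ) * ((Complex.exp (2 * Real.pi * Complex.I * t) +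
    ((ε : ℤ) : ℂ) * Complex.exp (2 * Real.pi * Complex.I * (-t))) / 2)

theorem wave_one (t : ℝ) : wave 1 t = (Real.cos (2 * Real.pi * t) : ℝ) := by
  rw [wave, Complex.ofReal_cos, Complex.cos]
  push_cast
  rw [one_mul, one_mul]
  congr 3 <;> ring

theorem wave_neg_one (t : ℝ) :
    wave (-1) t = -Complex.I * (Real.sin (2 * Real.pi * t) : ℝ) := by
  have hpos : 2 * Real.pi * Complex.I * t = (2 * Real.pi * t) * Complex.I := by ring
  have hneg : 2 * Real.pi * Complex.I * (-t) = -(2 * Real.pi * t) * Complex.I := by ring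
  rw [wave, Complex.ofReal_sin, Complex.sin, hpos, hneg]
  push_cast
  linear_combination ((1 : ℂ) / 2) * (Complex.exp (-(2 * Real.pi * t) * Complex.I) -
    Complex.exp ((2 * Real.pi * t) * Complex.I)) * Complex.I_sq

theorem norm_wave_le (t : ℝ) : ‖wave ε t‖ ≤ 1 := by
  rcases Int.units_eq_one_or ε with rfl | rfl
  · rw [wave_one, Complex.norm_real]
    exact Real.abs_cos_le_one _
  · rw [wave_neg_one, norm_mul, norm_neg, Complex.norm_I, one_mul, Complex.norm_real]
    exact Real.abs_sin_le_one _

theorem norm_wave_sub_le (s t : ℝ) :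
    ‖wave ε s - wave ε t‖ ≤ 2 * Real.pi * |s - t| := by
  have hscale : 2 * Real.pi * |s - t| = |2 * Real.pi * s - 2 * Real.pi * t| := by
    rw [← mul_sub, abs_mul, abs_of_pos Real.two_pi_pos]
  rw [hscale]
  rcases Int.units_eq_one_or ε with rfl | rfl
  · rw [wave_one, wave_one, ← Complex.ofReal_sub, Complex.norm_real]
    exact Real.abs_cos_sub_cos_le _ _
  · rw [wave_neg_one, wave_neg_one, ← mul_sub, norm_mul, norm_neg, Complex.norm_I, one_mul,
      ← Complex.ofReal_sub, Complex.norm_real]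
    exact Real.abs_sin_sub_sin_le _ _

theorem wave_natCast_div [NeZero N] (p : ℕ) :
    wave ε (p / N) = ((ε : ℤ) : ℂ) * ((ZMod.stdAddChar (p : ZMod N) +
      ((ε : ℤ) : ℂ) * ZMod.stdAddChar (-p : ZMod N)) / 2) := by
  have hpos := ZMod.stdAddChar_coe (N := N) (p : ℤ)
  have hneg := ZMod.stdAddChar_coe (N := N) (-p : ℤ)
  push_cast at hpos hneg
  rw [wave, hpos, hneg]
  push_cast
  ring_nf

end Parity

section Modulus

variable {N : ℕ} (ε : ℤˣ)

/-- The contribution of the modulus `N` to `T̃_ε`, evaluated at the prime `p`. -/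
def modulusTerm (ε : ℤˣ) (N p : ℕ) : ℂ :=
  ∑ χ ∈ primitiveChars ε N, χ (p : ZMod N) / tau χ +
    ((ε : ℤ) : ℂ) * (1 / (N : ℂ) * ∑ χ ∈ imprimitiveChars ε N, tau (star χ) * χ (p : ZMod N))

theorem div_tau_eq [NeZero N] {χ : DirichletCharacter ℂ N} (hχ : χ ∈ primitiveChars ε N) (z : ℂ) :
    z / tau χ = ((ε : ℤ) : ℂ) * (1 / (N : ℂ) * (tau (star χ) * z)) := by
  simp only [primitiveChars, Finset.mem_filter_univ] at hχ
  obtain ⟨hprimitive, hparity⟩ := hχ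
  have hε := intCast_units_mul_self ε
  have hN : (N : ℂ) ≠ 0 := Nat.cast_ne_zero.2 (NeZero.ne N)
  have hmul : tau χ * tau (star χ) = ((ε : ℤ) : ℂ) * N := by
    rw [tau_mul_tau_star hprimitive, hparity]
  have hτ : tau χ ≠ 0 := left_ne_zero_of_mul
    (hmul ▸ mul_ne_zero (left_ne_zero_of_mul_eq_one hε) hN)
  rw [div_eq_iff hτ]
  field_simp
  linear_combination (-((ε : ℤ) : ℂ) * z) * hmul - z * N * hε

theorem primitiveChars_union_imprimitiveChars [NeZero N]
    [DecidableEq (DirichletCharacter ℂ N)] (hN : N ≠ 1) :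
    primitiveChars ε N ∪ imprimitiveChars ε N = (charsOfParity ε N).erase 1 := by
  have hne_one : ∀ χ : DirichletCharacter ℂ N, χ.IsPrimitive → χ ≠ 1 := by
    rintro _ h rfl
    rw [DirichletCharacter.isPrimitive_def, DirichletCharacter.conductor_one] at h
    exact hN h.symm
  ext χ
  simp only [primitiveChars, imprimitiveChars, charsOfParity, Finset.mem_union,
    Finset.mem_erase, Finset.mem_filter_univ]
  have := hne_one χ
  tauto

theorem disjoint_primitiveChars_imprimitiveChars :
    Disjoint (primitiveChars ε N) (imprimitiveChars ε N) := by
  simp only [Finset.disjoint_left, primitiveChars, imprimitiveChars, Finset.mem_filter_univ]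
  exact fun _ hprimitive himprimitive => himprimitive.1 hprimitive.1

theorem modulusTerm_eq [NeZero N] [DecidableEq (DirichletCharacter ℂ N)] (hN : N ≠ 1) (p : ℕ) :
    modulusTerm ε N p = ((ε : ℤ) : ℂ) * (1 / (N : ℂ) *
      ∑ χ ∈ (charsOfParity ε N).erase 1, tau (star χ) * χ (p : ZMod N)) := by
  rw [modulusTerm, Finset.sum_congr rfl fun χ hχ => div_tau_eq ε hχ (χ (p : ZMod N)),
    ← Finset.mul_sum, ← Finset.mul_sum, ← mul_add, ← mul_add,
    ← Finset.sum_union (disjoint_primitiveChars_imprimitiveChars ε),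
    primitiveChars_union_imprimitiveChars ε hN]

theorem norm_sum_erase_sub_sum_le {ι E : Type*} [DecidableEq ι] [SeminormedAddCommGroup E]
    (s : Finset ι) (i : ι) (f : ι → E) :
    ‖∑ j ∈ s.erase i, f j - ∑ j ∈ s, f j‖ ≤ ‖f i‖ := by
  by_cases hi : i ∈ s
  · rw [← Finset.sum_erase_add s f hi, sub_add_cancel_left, norm_neg]
  · simp [Finset.erase_eq_of_notMem hi]

theorem norm_modulusTerm_sub_le_of_coprime [NeZero N] (hN : N ≠ 1) {p : ℕ} (hp : p.Coprime N) :
    ‖modulusTerm ε N p - ((N.totient / N : ℝ) : ℂ) * wave ε (p / N)‖ ≤ 1 / N := by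
  classical
  set f : DirichletCharacter ℂ N → ℂ := fun χ => tau (star χ) * χ (p : ZMod N)
  have hprincipal : ‖f 1‖ ≤ 1 := by
    simp only [f, MulChar.star_eq_inv, inv_one, norm_mul]
    exact mul_le_one₀ norm_tau_one_le (norm_nonneg _) (DirichletCharacter.norm_le_one _ _)
  have hdiff : modulusTerm ε N p - ((N.totient / N : ℝ) : ℂ) * wave ε (p / N) =
      ((ε : ℤ) : ℂ) * (1 / (N : ℂ) *
        (∑ χ ∈ (charsOfParity ε N).erase 1, f χ - ∑ χ ∈ charsOfParity ε N, f χ)) := by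
    rw [modulusTerm_eq ε hN, wave_natCast_div,
      sum_charsOfParity_tau_star_mul_apply ε ((ZMod.isUnit_iff_coprime _ _).2 hp)]
    push_cast
    ring
  rw [hdiff, norm_mul, norm_mul, norm_intCast_units, one_mul, norm_div, norm_one,
    Complex.norm_natCast]
  exact mul_le_of_le_one_right (by positivity)
    ((norm_sum_erase_sub_sum_le _ _ _).trans hprincipal)

theorem totient_div_le_one (N : ℕ) : (N.totient / N : ℝ) ≤ 1 :=
  div_le_one_of_le₀ (Nat.cast_le.2 (Nat.totient_le N)) (Nat.cast_nonneg N)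

theorem norm_modulusTerm_sub_le_of_not_coprime {p : ℕ} (hp : ¬ p.Coprime N) :
    ‖modulusTerm ε N p - ((N.totient / N : ℝ) : ℂ) * wave ε (p / N)‖ ≤ 1 := by
  have hzero : ∀ χ : DirichletCharacter ℂ N, χ (p : ZMod N) = 0 := fun χ =>
    MulChar.map_nonunit _ (mt (ZMod.isUnit_iff_coprime _ _).1 hp)
  simp only [modulusTerm, hzero, zero_div, mul_zero, Finset.sum_const_zero, add_zero, zero_sub,
    norm_neg, norm_mul, Complex.norm_real]
  rw [Real.norm_of_nonneg (by positivity)]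
  exact mul_le_one₀ (totient_div_le_one N) (norm_nonneg _) (norm_wave_le ε _)

theorem norm_modulusTerm_sub_le [NeZero N] (hN : N ≠ 1) {p : ℕ} (hp : p.Prime) :
    ‖modulusTerm ε N p - ((N.totient / N : ℝ) : ℂ) * wave ε (p / N)‖ ≤
      1 / N + if p ∣ N then 1 else 0 := by
  split_ifs with hpN
  · exact (norm_modulusTerm_sub_le_of_not_coprime ε
      (hp.coprime_iff_not_dvd.not_left.2 hpN)).trans (le_add_of_nonneg_left (by positivity))
  · rw [add_zero]
    exact norm_modulusTerm_sub_le_of_coprime ε hN (hp.coprime_iff_not_dvd.2 hpN)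

end Modulus

section Average

variable (ε : ℤˣ) {y X δ : ℝ}

theorem Ttilde_eq (y X δ : ℝ) :
    Ttilde ε y X δ = ((1 / X ^ δ : ℝ) : ℂ) *
      ∑ N ∈ shortConductors X δ, modulusTerm ε N (primeCeil (y * X)) := by
  simp only [Ttilde, Qtilde, Etilde, modulusTerm]
  rw [Finset.sum_add_distrib, ← Finset.mul_sum]
  push_cast
  ring

theorem card_shortConductors_filter_dvd_le (hX : 0 ≤ X) {m : ℕ} (hm : 0 < m) :
    (((shortConductors X δ).filter (m ∣ ·)).card : ℝ) ≤ X ^ δ * (1 / m) + 1 := by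
  have hcount := abs_card_filter_dvd_sub_le hX
    (le_add_of_nonneg_right (Real.rpow_nonneg hX δ)) hm
  rw [add_sub_cancel_left, abs_le] at hcount
  have hle : (((shortConductors X δ).filter (m ∣ ·)).card : ℝ) ≤
      (((Finset.Icc ⌈X⌉₊ ⌊X + X ^ δ⌋₊).filter (m ∣ ·)).card : ℝ) :=
    mod_cast Finset.card_le_card (Finset.filter_subset_filter _ (Finset.filter_subset _ _))
  linarith

theorem abs_div_sub_le_of_mem_shortConductors (hX : 0 < X) {N : ℕ}
    (hN : N ∈ shortConductors X δ) {p : ℝ} (hp : 0 ≤ p) (y : ℝ) :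
    |p / N - y| ≤ p / X * (X ^ δ / X) + |p / X - y| := by
  obtain ⟨hXN, hNX⟩ := mem_shortConductors_bounds hX hN
  have hN0 : (0 : ℝ) < N := hX.trans_le hXN
  have hchange : |p / N - p / X| ≤ p / X * (X ^ δ / X) := by
    rw [show p / N - p / X = -(p / X * ((N - X) / N)) by field_simp; ring, abs_neg,
      abs_of_nonneg (mul_nonneg (by positivity) (div_nonneg (sub_nonneg.2 hXN) hN0.le))]
    gcongr
    linarith
  exact (abs_sub_le _ (p / X) _).trans (by gcongr)

theorem norm_modulusTerm_sub_wave_le (hX : 2 ≤ X) {N : ℕ} (hN : N ∈ shortConductors X δ)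
    {p : ℕ} (hp : p.Prime) (y : ℝ) :
    ‖modulusTerm ε N p - ((N.totient / N : ℝ) : ℂ) * wave ε y‖ ≤
      (1 / X + 2 * Real.pi * (p / X * (X ^ δ / X) + |p / X - y|)) + if p ∣ N then 1 else 0 := by
  have hX0 : 0 < X := by linarith
  have hXN := (mem_shortConductors_bounds hX0 hN).1
  have hN2 : 2 ≤ N := mod_cast hX.trans hXN
  have : NeZero N := ⟨by omega⟩
  have hinv : 1 / (N : ℝ) ≤ 1 / X := by gcongr
  have hmodulus := norm_modulusTerm_sub_le ε (by omega : N ≠ 1) hp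
  have hwave : ‖((N.totient / N : ℝ) : ℂ) * (wave ε (p / N) - wave ε y)‖ ≤
      2 * Real.pi * (p / X * (X ^ δ / X) + |p / X - y|) := by
    rw [norm_mul, Complex.norm_real, Real.norm_of_nonneg (by positivity)]
    refine (mul_le_of_le_one_left (norm_nonneg _) (totient_div_le_one N)).trans
      ((norm_wave_sub_le ε _ _).trans ?_)
    gcongr
    exact abs_div_sub_le_of_mem_shortConductors hX0 hN p.cast_nonneg y
  calc _ = ‖(modulusTerm ε N p - ((N.totient / N : ℝ) : ℂ) * wave ε (p / N)) +
        ((N.totient / N : ℝ) : ℂ) * (wave ε (p / N) - wave ε y)‖ := by ring_nf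
    _ ≤ _ := (norm_add_le _ _).trans (by linarith)

theorem average_le_of_le_add_dvd (hX : 0 < X) {f : ℕ → ℝ} {c : ℝ} (hc : 0 ≤ c) {p : ℕ}
    (hp : 0 < p) (hf : ∀ N ∈ shortConductors X δ, f N ≤ c + if p ∣ N then 1 else 0) :
    1 / X ^ δ * ∑ N ∈ shortConductors X δ, f N ≤
      (1 + X ^ (-δ)) * c + (1 / p + X ^ (-δ)) := by
  have hcard : ((shortConductors X δ).card : ℝ) ≤ X ^ δ + 1 := by
    simpa using card_shortConductors_filter_dvd_le (δ := δ) hX.le one_pos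
  have : 0 < X ^ δ := Real.rpow_pos_of_pos hX δ
  calc _ ≤ 1 / X ^ δ * ∑ N ∈ shortConductors X δ, (c + if p ∣ N then 1 else 0) := by
        gcongr with N hN
        exact hf N hN
    _ = 1 / X ^ δ * ((shortConductors X δ).card * c +
          ((shortConductors X δ).filter (p ∣ ·)).card) := by
        rw [Finset.sum_add_distrib, Finset.sum_const, nsmul_eq_mul, Finset.sum_boole]
    _ ≤ 1 / X ^ δ * ((X ^ δ + 1) * c + (X ^ δ * (1 / p) + 1)) := by
        gcongr
        exact card_shortConductors_filter_dvd_le hX.le hp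
    _ = (1 + X ^ (-δ)) * c + (1 / p + X ^ (-δ)) := by
        rw [Real.rpow_neg hX.le]
        field_simp

theorem norm_Ttilde_sub_le (hX : 2 ≤ X) :
    ‖Ttilde ε y X δ - ((1 / X ^ δ * ∑ N ∈ shortConductors X δ, (N.totient : ℝ) / N : ℝ) : ℂ) *
        wave ε y‖ ≤
      (1 + X ^ (-δ)) * (1 / X + 2 * Real.pi *
        (primeCeil (y * X) / X * (X ^ δ / X) + |primeCeil (y * X) / X - y|)) +
      (1 / primeCeil (y * X) + X ^ (-δ)) := by
  have hX0 : 0 < X := by linarith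
  have hp := prime_primeCeil (y * X)
  set p := primeCeil (y * X) with hp_def
  have hdiff : Ttilde ε y X δ -
      ((1 / X ^ δ * ∑ N ∈ shortConductors X δ, (N.totient : ℝ) / N : ℝ) : ℂ) * wave ε y =
      ((1 / X ^ δ : ℝ) : ℂ) * ∑ N ∈ shortConductors X δ,
        (modulusTerm ε N p - ((N.totient / N : ℝ) : ℂ) * wave ε y) := by
    rw [Ttilde_eq, Finset.sum_sub_distrib, ← Finset.sum_mul, ← hp_def]
    push_cast
    ring
  rw [hdiff, norm_mul, Complex.norm_real, Real.norm_of_nonneg (by positivity)]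
  refine (mul_le_mul_of_nonneg_left (norm_sum_le _ _) (by positivity)).trans ?_
  exact average_le_of_le_add_dvd hX0 (by positivity) hp.pos fun N hN =>
    norm_modulusTerm_sub_wave_le ε hX hN hp y

theorem tendsto_primeCeil_mul_div (hy : 0 < y) :
    Tendsto (fun X : ℝ => (primeCeil (y * X) : ℝ) / X) atTop (𝓝 y) := by
  have hlim := (tendsto_primeCeil_div.comp (tendsto_id.const_mul_atTop hy)).const_mul y
  rw [mul_one] at hlim
  refine hlim.congr fun X => ?_
  simp only [Function.comp, id]
  field_simp

theorem tendsto_norm_Ttilde_sub_bound (hδ : δ ∈ Set.Ioo (0 : ℝ) 1) (hy : 0 < y) :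
    Tendsto (fun X : ℝ => (1 + X ^ (-δ)) * (1 / X + 2 * Real.pi *
        (primeCeil (y * X) / X * (X ^ δ / X) + |primeCeil (y * X) / X - y|)) +
      (1 / primeCeil (y * X) + X ^ (-δ))) atTop (𝓝 0) := by
  have hratio := tendsto_primeCeil_mul_div hy
  have hneg : Tendsto (fun X : ℝ => X ^ (-δ)) atTop (𝓝 0) := tendsto_rpow_neg_atTop hδ.1
  have hsub : Tendsto (fun X : ℝ => X ^ δ / X) atTop (𝓝 0) := by
    refine (tendsto_rpow_neg_atTop (sub_pos.2 hδ.2)).congr' ?_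
    filter_upwards [eventually_gt_atTop 0] with X hX
    rw [neg_sub, Real.rpow_sub hX, Real.rpow_one]
  have hinv : Tendsto (fun X : ℝ => 1 / X) atTop (𝓝 0) := by
    simpa using tendsto_inv_atTop_zero
  have hprime : Tendsto (fun X : ℝ => 1 / (primeCeil (y * X) : ℝ)) atTop (𝓝 0) :=
    hinv.comp (tendsto_atTop_mono (fun X => le_primeCeil (y * X))
      (tendsto_id.const_mul_atTop hy))
  simpa using ((hneg.const_add 1).mul (hinv.add (((hratio.mul hsub).add
    (hratio.sub_const y).abs).const_mul (2 * Real.pi)))).add (hprime.add hneg)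

theorem tendsto_Ttilde (hδ : δ ∈ Set.Ioo (0 : ℝ) 1) (hy : 0 < y) :
    Tendsto (fun X : ℝ => Ttilde ε y X δ) atTop
      (𝓝 (((5 / Real.pi ^ 2 : ℝ) : ℂ) * wave ε y)) := by
  have hmain := ((Complex.continuous_ofReal.tendsto _).comp
    (tendsto_average_totient_div hδ)).mul_const (wave ε y)
  refine tendsto_of_tendsto_of_dist hmain (squeeze_zero' (.of_forall fun _ => dist_nonneg) ?_
    (tendsto_norm_Ttilde_sub_bound hδ hy))
  filter_upwards [eventually_ge_atTop 2] with X hX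
  rw [dist_comm, dist_eq_norm]
  exact norm_Ttilde_sub_le ε hX

end Average

end Murmuration

end

theorem mainTheorem5 (δ : ℝ) (hδ : δ ∈ Set.Ioo (0 : ℝ) 1) (y : ℝ) (hy : 0 < y) :
    Tendsto (fun X : ℝ => Murmuration.Ttilde 1 y X δ) atTop
      (𝓝 (((5 / Real.pi ^ 2 * Real.cos (2 * Real.pi * y) : ℝ) : ℂ))) ∧
    Tendsto (fun X : ℝ => Murmuration.Ttilde (-1) y X δ) atTop
      (𝓝 (-Complex.I * ((5 / Real.pi ^ 2 * Real.sin (2 * Real.pi * y) : ℝ) : ℂ))) := by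
  constructor
  · have hlim := Murmuration.tendsto_Ttilde 1 hδ hy
    rwa [Murmuration.wave_one, ← Complex.ofReal_mul] at hlim
  · have hlim := Murmuration.tendsto_Ttilde (-1) hδ hy
    rwa [Murmuration.wave_neg_one, mul_left_comm, ← Complex.ofReal_mul] at hlim
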